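/- Let $0<q<1$. Let $\mathcal A=\mathcal A(SU_q(2))$ be the $*$-algebra generated by $a,c$ with $ac=qca$, $ac^*=qc^*a$, $cc^*=c^*c$, $a^*a+c^*c=aa^*+q^2cc^*=1$, with coproduct $\Delta a=a\otimes a-qc^*\otimes c$, $\Delta c=c\otimes a+a^*\otimes c$, $\Delta a^*=a^*\otimes a^*-qc\otimes c^*$, $\Delta c^*=a\otimes c^*+c^*\otimes a^*$. The generators $K^{\pm1},E,F$ of $\mathcal U_q(su(2))$ act on $\mathcal A$ by $h\triangleright x=x_{(1)}\langle h,x_{(2)}\rangle$, where $\langle K^{\pm1},a\rangle=q^{\mp1/2}$, $\langle K^{\pm1},a^*\rangle=q^{\pm1/2}$, $\langle E,c\rangle=1$, $\langle F,c^*\rangle=-q^{-1}$, all other pairings of generators vanish, $\langle K^{\pm1},\cdot\rangle$ are characters, and for $h=E,F$ one has $\langle h,xy\rangle=\langle h,x\rangle\langle K,y\rangle+\langle K^{-1},x\rangle\langle h,y\rangle$. Let $\mathcal B=\mathcal A(S^2_q)\subset\mathcal A$ be the coordinate algebra of the standard Podleś sphere, i.e. the coinvariants of the right coaction $\Delta_R=(\mathrm{id}\otimes\pi)\Delta$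 of $\mathbb C[z,z^{-1}]$, where $\pi(a)=z$, $\pi(a^*)=z^{-1}$, $\pi(c)=\pi(c^*)=0$. For $n\in\mathbb Z$ let $\mathcal L_n=\{x\in\mathcal A: K\triangleright x=q^{n/2}x\}$, a left $\mathcal B$-module. Let $\Omega^1(SU_q(2))$ be the free left $\mathcal A$-module on $\omega_z,\omega_-,\omega_+$, with right multiplication $\omega_zx=(K^4\triangleright x)\omega_z$, $\omega_\pm x=(K^2\triangleright x)\omega_\pm$ and differential $\mathrm dx=(X_+\triangleright x)\omega_++(X_-\triangleright x)\omega_-+(X_z\triangleright x)\omega_z$, where $X_+=q^{1/2}EK$, $X_-=q^{-1/2}FK$, $X_z=(1-K^4)/(1-q^{-2})$. Let $\Omega^1(S^2_q)=\mathcal B\,\mathrm d\mathcal B$. Let $\Pi_z$ be the left $\mathcal A$-linear projection with $\Pi_z\omega_z=\omega_z$, $\Pi_z\omega_\pm=0$. For $n\ge0$ put $\Psi^{(n)}_\mu=\sqrt{\beta_{n,\mu}}\,c^{*\mu}a^{*\,n-\mu}$ with $\beta_{n,\mu}=q^{2\mu}\prod_{j=0}^{\mu-1}\frac{1-q^{-2(n-j)}}{1-q^{-2(j+1)}}$;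 for $n\le0$ put $\Psi^{(n)}_\mu=\sqrt{\alpha_{n,\mu}}\,c^{|n|-\mu}a^{\mu}$ with $\alpha_{n,\mu}=\prod_{j=0}^{|n|-\mu-1}\frac{1-q^{2(|n|-j)}}{1-q^{2(j+1)}}$ ($0\le\mu\le|n|$; both give $1$ for $n=0$). Let $\mathfrak p^{(n)}\in \mathrm{Mat}_{|n|+1}(\mathcal B)$ have entries $\mathfrak p^{(n)}_{\mu\nu}=\Psi^{(n)}_\mu(\Psi^{(n)}_\nu)^*$, and let $\mathcal E_n=\mathcal B^{|n|+1}\mathfrak p^{(n)}$ (row vectors). **Proposition.** For every $n\in\mathbb Z$: (i) $\phi\mapsto\sigma_\phi:=\big(\phi\,(\Psi^{(n)}_\mu)^*\big)_\mu$ is an isomorphism $\mathcal L_n\to\mathcal E_n$ of left $\mathcal B$-modules, with inverse $f\,\mathfrak p^{(n)}\mapsto\sum_\mu f_\mu\Psi^{(n)}_\mu$. (ii) The multiplication map $\Omega^1(S^2_q)\otimes_{\mathcal B}\mathcal L_n\to\Omega^1(SU_q(2))$, $\alpha\otimes\phi\mapsto\alpha\phi$, is injective, and $(\mathrm{id}-\Pi_z)\mathrm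 d\phi$ lies in its image for all $\phi\in\mathcal L_n$. Hence $\nabla=(\mathrm{id}-\Pi_z)\circ\mathrm d$ is a well-defined map $\nabla:\mathcal L_n\to\Omega^1(S^2_q)\otimes_{\mathcal B}\mathcal L_n$. (iii) Extend $\sigma$ to the isomorphism $\mathrm{id}\otimes\sigma:\Omega^1(S^2_q)\otimes_{\mathcal B}\mathcal L_n\to\Omega^1(S^2_q)\otimes_{\mathcal B}\mathcal E_n$ and write $\sigma_{\nabla\phi}:=(\mathrm{id}\otimes\sigma)(\nabla\phi)$. Then $\sigma_{\nabla\phi}$ is the Grassmann connection of $\mathfrak p^{(n)}$ applied to $\sigma_\phi$, that is, for every $\phi\in\mathcal L_n$, $$(\mathrm d\sigma_\phi)\,\mathfrak p^{(n)}:=\sum_\nu \mathrm d(\sigma_\phi)_\nu\otimes(\mathfrak p^{(n)}_{\nu\mu})_\mu=\sigma_{\nabla\phi}\quad\text{in }\Omega^1(S^2_q)\otimes_{\mathcal B}\mathcal E_n .$$ In components, $\sum_\nu \mathrm d(\sigma_\phi)_\nu\,\mathfrak p^{(n)}_{\nu\mu}=\big((\mathrm{id}-\Pi_z)\mathrm d\phi\big)(\Psi^{(n)}_\mu)^*$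 in $\Omega^1(SU_q(2))$ for $0\le\mu\le|n|$. -/

import Mathlib

open scoped TensorProduct

noncomputable section

namespace QuantumHopf

/-- The generators `a, a⋆, c, c⋆` of the coordinate algebra of `SU_q(2)`. -/
inductive Gen : Type
  | a | aStar | c | cStar

/-- The deformation parameter `q ∈ (0, 1)` as a complex number. -/
def qC (q : Set.Ioo (0 : ℝ) 1) : ℂ := ((q : ℝ) : ℂ)

/-- The defining relations of the coordinate algebra of `SU_q(2)`, together with their adjoints,
for a quadruple `(a, a⋆, c, c⋆)` of elements of a complex algebra. -/
structure IsSUqQuadruple (q : Set.Ioo (0 : ℝ) 1) {S : Type*} [Ring S] [Algebra ℂ S]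
    (a aS c cS : S) : Prop where
  a_c : a * c = qC q • (c * a)
  a_cS : a * cS = qC q • (cS * a)
  cS_aS : cS * aS = qC q • (aS * cS)
  c_aS : c * aS = qC q • (aS * c)
  c_cS : c * cS = cS * c
  aS_a : aS * a + cS * c = 1
  a_aS : a * aS + qC q ^ 2 • (c * cS) = 1

/-- The relations of `IsSUqQuadruple` imposed on the generators of the free algebra. -/
inductive Rel (q : Set.Ioo (0 : ℝ) 1) : FreeAlgebra ℂ Gen → FreeAlgebra ℂ Gen → Prop
  | a_c : Rel q (FreeAlgebra.ι ℂ Gen.a * FreeAlgebra.ι ℂ Gen.c)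
      (qC q • (FreeAlgebra.ι ℂ Gen.c * FreeAlgebra.ι ℂ Gen.a))
  | a_cS : Rel q (FreeAlgebra.ι ℂ Gen.a * FreeAlgebra.ι ℂ Gen.cStar)
      (qC q • (FreeAlgebra.ι ℂ Gen.cStar * FreeAlgebra.ι ℂ Gen.a))
  | cS_aS : Rel q (FreeAlgebra.ι ℂ Gen.cStar * FreeAlgebra.ι ℂ Gen.aStar)
      (qC q • (FreeAlgebra.ι ℂ Gen.aStar * FreeAlgebra.ι ℂ Gen.cStar))
  | c_aS : Rel q (FreeAlgebra.ι ℂ Gen.c * FreeAlgebra.ι ℂ Gen.aStar)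
      (qC q • (FreeAlgebra.ι ℂ Gen.aStar * FreeAlgebra.ι ℂ Gen.c))
  | c_cS : Rel q (FreeAlgebra.ι ℂ Gen.c * FreeAlgebra.ι ℂ Gen.cStar)
      (FreeAlgebra.ι ℂ Gen.cStar * FreeAlgebra.ι ℂ Gen.c)
  | aS_a : Rel q (FreeAlgebra.ι ℂ Gen.aStar * FreeAlgebra.ι ℂ Gen.a
      + FreeAlgebra.ι ℂ Gen.cStar * FreeAlgebra.ι ℂ Gen.c) 1
  | a_aS : Rel q (FreeAlgebra.ι ℂ Gen.a * FreeAlgebra.ι ℂ Gen.aStar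
      + qC q ^ 2 • (FreeAlgebra.ι ℂ Gen.c * FreeAlgebra.ι ℂ Gen.cStar)) 1

/-- The coordinate algebra `A(SU_q(2))`. -/
def SUq (q : Set.Ioo (0 : ℝ) 1) : Type := RingQuot (Rel q)

instance (q : Set.Ioo (0 : ℝ) 1) : Ring (SUq q) := inferInstanceAs (Ring (RingQuot (Rel q)))

instance (q : Set.Ioo (0 : ℝ) 1) : Algebra ℂ (SUq q) :=
  inferInstanceAs (Algebra ℂ (RingQuot (Rel q)))

namespace SUq

/-- The canonical projection of the free algebra onto `A(SU_q(2))`. -/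
def proj (q : Set.Ioo (0 : ℝ) 1) : FreeAlgebra ℂ Gen →ₐ[ℂ] SUq q := RingQuot.mkAlgHom ℂ (Rel q)

theorem proj_rel {q : Set.Ioo (0 : ℝ) 1} {u v : FreeAlgebra ℂ Gen} (h : Rel q u v) :
    proj q u = proj q v := RingQuot.mkAlgHom_rel ℂ h

/-- The generator `a`. -/
def a (q : Set.Ioo (0 : ℝ) 1) : SUq q := proj q (FreeAlgebra.ι ℂ Gen.a)
/-- The generator `a⋆`. -/
def aS (q : Set.Ioo (0 : ℝ) 1) : SUq q := proj q (FreeAlgebra.ι ℂ Gen.aStar)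
/-- The generator `c`. -/
def c (q : Set.Ioo (0 : ℝ) 1) : SUq q := proj q (FreeAlgebra.ι ℂ Gen.c)
/-- The generator `c⋆`. -/
def cS (q : Set.Ioo (0 : ℝ) 1) : SUq q := proj q (FreeAlgebra.ι ℂ Gen.cStar)

theorem isSUqQuadruple (q : Set.Ioo (0 : ℝ) 1) :
    IsSUqQuadruple q (a q) (aS q) (c q) (cS q) where
  a_c := by simpa only [a, aS, c, cS, map_mul, map_smul] using proj_rel (Rel.a_c (q := q))
  a_cS := by simpa only [a, aS, c, cS, map_mul, map_smul] using proj_rel (Rel.a_cS (q := q))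
  cS_aS := by simpa only [a, aS, c, cS, map_mul, map_smul] using proj_rel (Rel.cS_aS (q := q))
  c_aS := by simpa only [a, aS, c, cS, map_mul, map_smul] using proj_rel (Rel.c_aS (q := q))
  c_cS := by simpa only [a, aS, c, cS, map_mul, map_smul] using proj_rel (Rel.c_cS (q := q))
  aS_a := by simpa only [a, aS, c, cS, map_mul, map_add, map_one] using proj_rel (Rel.aS_a (q := q))
  a_aS := by
    simpa only [a, aS, c, cS, map_mul, map_add, map_one, map_smul] using proj_rel (Rel.a_aS (q := q))

/-- The universal property of `A(SU_q(2))`. -/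
def lift (q : Set.Ioo (0 : ℝ) 1) {S : Type*} [Ring S] [Algebra ℂ S] {x xS y yS : S}
    (h : IsSUqQuadruple q x xS y yS) : SUq q →ₐ[ℂ] S :=
  RingQuot.liftAlgHom ℂ
    ⟨FreeAlgebra.lift ℂ (fun g : Gen => match g with
      | Gen.a => x | Gen.aStar => xS | Gen.c => y | Gen.cStar => yS), by
      intro u v huv
      cases huv <;> simp only [map_mul, map_add, map_one, map_smul, FreeAlgebra.lift_ι_apply,
        h.a_c, h.a_cS, h.cS_aS, h.c_aS, h.aS_a]
      · exact h.c_cS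
      · exact h.a_aS⟩

theorem lift_proj (q : Set.Ioo (0 : ℝ) 1) {S : Type*} [Ring S] [Algebra ℂ S] {x xS y yS : S}
    (h : IsSUqQuadruple q x xS y yS) (u : FreeAlgebra ℂ Gen) :
    lift q h (proj q u) = FreeAlgebra.lift ℂ (fun g : Gen => match g with
      | Gen.a => x | Gen.aStar => xS | Gen.c => y | Gen.cStar => yS) u :=
  RingQuot.liftAlgHom_mkAlgHom_apply ℂ _ _ _

section
variable (q : Set.Ioo (0 : ℝ) 1) {S : Type*} [Ring S] [Algebra ℂ S] {x xS y yS : S}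
  (h : IsSUqQuadruple q x xS y yS)

@[simp] theorem lift_a : lift q h (a q) = x := by simp [a, lift_proj]
@[simp] theorem lift_aS : lift q h (aS q) = xS := by simp [aS, lift_proj]
@[simp] theorem lift_c : lift q h (c q) = y := by simp [c, lift_proj]
@[simp] theorem lift_cS : lift q h (cS q) = yS := by simp [cS, lift_proj]
end

theorem algHom_ext (q : Set.Ioo (0 : ℝ) 1) {S : Type*} [Semiring S] [Algebra ℂ S]
    {f g : SUq q →ₐ[ℂ] S} (ha : f (a q) = g (a q)) (haS : f (aS q) = g (aS q))
    (hc : f (c q) = g (c q)) (hcS : f (cS q) = g (cS q)) : f = g := by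
  refine RingQuot.ringQuot_ext' ℂ _ _ (FreeAlgebra.hom_ext (funext fun t => ?_))
  cases t
  · exact ha
  · exact haS
  · exact hc
  · exact hcS

/-- The opposite algebra of `A(SU_q(2))` with complex conjugate scalar multiplication; the
involution of `A(SU_q(2))` is a homomorphism into it. -/
def ConjOp (q : Set.Ioo (0 : ℝ) 1) : Type := (SUq q)ᵐᵒᵖ

instance (q : Set.Ioo (0 : ℝ) 1) : Ring (ConjOp q) := inferInstanceAs (Ring (SUq q)ᵐᵒᵖ)

instance (q : Set.Ioo (0 : ℝ) 1) : Algebra ℂ (ConjOp q) :=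
  RingHom.toAlgebra' ((algebraMap ℂ (SUq q)ᵐᵒᵖ).comp (starRingEnd ℂ))
    (fun r x => Algebra.commutes (A := (SUq q)ᵐᵒᵖ) (starRingEnd ℂ r) x)

/-- The identity map from `A(SU_q(2))` to `ConjOp`. -/
def toConjOp (q : Set.Ioo (0 : ℝ) 1) (x : SUq q) : ConjOp q := MulOpposite.op x

/-- The identity map from `ConjOp` to `A(SU_q(2))`. -/
def ofConjOp (q : Set.Ioo (0 : ℝ) 1) (x : ConjOp q) : SUq q := MulOpposite.unop x

theorem toConjOp_smul (q : Set.Ioo (0 : ℝ) 1) (r : ℂ) (x : SUq q) :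
    r • toConjOp q x = toConjOp q (starRingEnd ℂ r • x) := by
  refine (Algebra.smul_def (A := ConjOp q) r _).trans ?_
  exact (Algebra.smul_def (A := (SUq q)ᵐᵒᵖ) (starRingEnd ℂ r) (MulOpposite.op x)).symm

theorem isSUqQuadruple_conjOp (q : Set.Ioo (0 : ℝ) 1) :
    IsSUqQuadruple q (toConjOp q (aS q)) (toConjOp q (a q)) (toConjOp q (cS q))
      (toConjOp q (c q)) := by
  have h := isSUqQuadruple q
  have hq : starRingEnd ℂ (qC q) = qC q := Complex.conj_ofReal _
  have hm : ∀ x y : SUq q, toConjOp q x * toConjOp q y = toConjOp q (y * x) := fun _ _ => rfl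
  have ha : ∀ x y : SUq q, toConjOp q x + toConjOp q y = toConjOp q (x + y) := fun _ _ => rfl
  have h1 : toConjOp q 1 = 1 := rfl
  constructor <;> simp only [hm, toConjOp_smul, ha, map_pow, hq]
  · rw [h.cS_aS]
  · rw [h.c_aS]
  · rw [h.a_c]
  · rw [h.a_cS]
  · rw [h.c_cS]
  · rw [h.aS_a, h1]
  · rw [h.a_aS, h1]

/-- The involution of `A(SU_q(2))` as an algebra homomorphism to `ConjOp`. -/
def starHom (q : Set.Ioo (0 : ℝ) 1) : SUq q →ₐ[ℂ] ConjOp q := lift q (isSUqQuadruple_conjOp q)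

instance (q : Set.Ioo (0 : ℝ) 1) : Star (SUq q) := ⟨fun x => ofConjOp q (starHom q x)⟩

theorem star_def (q : Set.Ioo (0 : ℝ) 1) (x : SUq q) :
    star x = ofConjOp q (starHom q x) := rfl

@[simp] theorem star_a (q : Set.Ioo (0 : ℝ) 1) : star (a q) = aS q := by
  rw [star_def, starHom, lift_a]; rfl
@[simp] theorem star_aS (q : Set.Ioo (0 : ℝ) 1) : star (aS q) = a q := by
  rw [star_def, starHom, lift_aS]; rfl
@[simp] theorem star_c (q : Set.Ioo (0 : ℝ) 1) : star (c q) = cS q := by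
  rw [star_def, starHom, lift_c]; rfl
@[simp] theorem star_cS (q : Set.Ioo (0 : ℝ) 1) : star (cS q) = c q := by
  rw [star_def, starHom, lift_cS]; rfl

theorem star_add_aux (q : Set.Ioo (0 : ℝ) 1) (x y : SUq q) :
    star (x + y) = star x + star y := by
  rw [star_def, map_add]; rfl

theorem star_mul_aux (q : Set.Ioo (0 : ℝ) 1) (x y : SUq q) :
    star (x * y) = star y * star x := by
  rw [star_def, map_mul]; rfl

theorem star_smul_aux (q : Set.Ioo (0 : ℝ) 1) (r : ℂ) (x : SUq q) :
    star (r • x) = star r • star x := by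
  rw [star_def, map_smul]
  exact congrArg (ofConjOp q) (toConjOp_smul q r (ofConjOp q (starHom q x)))

theorem star_one_aux (q : Set.Ioo (0 : ℝ) 1) : star (1 : SUq q) = 1 := by
  rw [star_def, map_one]; rfl

theorem star_star_aux (q : Set.Ioo (0 : ℝ) 1) (x : SUq q) : star (star x) = x := by
  let f : SUq q →ₐ[ℂ] SUq q := AlgHom.ofLinearMap
    { toFun := fun x => star (star x)
      map_add' := fun x y => by simp only [star_add_aux]
      map_smul' := fun r x => by simp only [star_smul_aux, star_star, RingHom.id_apply] }
    (by simp [star_one_aux]) (fun x y => by simp [star_mul_aux])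
  have hf : f = AlgHom.id ℂ _ := by
    apply algHom_ext <;> simp [f]
  exact DFunLike.congr_fun hf x

instance (q : Set.Ioo (0 : ℝ) 1) : StarRing (SUq q) where
  star_involutive := star_star_aux q
  star_mul := star_mul_aux q
  star_add := star_add_aux q

instance (q : Set.Ioo (0 : ℝ) 1) : StarModule ℂ (SUq q) := ⟨star_smul_aux q⟩

end SUq

namespace SUq

theorem adjoin_eq_top (q : Set.Ioo (0 : ℝ) 1) :
    Algebra.adjoin ℂ ({a q, aS q, c q, cS q} : Set (SUq q)) = ⊤ := by
  set B := Algebra.adjoin ℂ ({a q, aS q, c q, cS q} : Set (SUq q)) with hB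
  have ha : a q ∈ B := Algebra.subset_adjoin (by simp)
  have haS : aS q ∈ B := Algebra.subset_adjoin (by simp)
  have hc : c q ∈ B := Algebra.subset_adjoin (by simp)
  have hcS : cS q ∈ B := Algebra.subset_adjoin (by simp)
  have h := isSUqQuadruple q
  have hr : IsSUqQuadruple q (⟨a q, ha⟩ : B) ⟨aS q, haS⟩ ⟨c q, hc⟩ ⟨cS q, hcS⟩ :=
    ⟨Subtype.ext h.a_c, Subtype.ext h.a_cS, Subtype.ext h.cS_aS, Subtype.ext h.c_aS,
      Subtype.ext h.c_cS, Subtype.ext h.aS_a, Subtype.ext h.a_aS⟩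
  have e : B.val.comp (lift q hr) = AlgHom.id ℂ (SUq q) := by
    apply algHom_ext <;> simp
  rw [eq_top_iff]
  intro x _
  have := DFunLike.congr_fun e x
  rw [← show (lift q hr x : SUq q) = x from this]
  exact (lift q hr x).2

theorem induction (q : Set.Ioo (0 : ℝ) 1) {P : SUq q → Prop}
    (hscalar : ∀ r : ℂ, P (algebraMap ℂ _ r)) (ha : P (a q)) (haS : P (aS q)) (hc : P (c q))
    (hcS : P (cS q)) (hadd : ∀ x y, P x → P y → P (x + y)) (hmul : ∀ x y, P x → P y → P (x * y))
    (x : SUq q) : P x := by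
  have hx : x ∈ Algebra.adjoin ℂ ({a q, aS q, c q, cS q} : Set (SUq q)) := by
    rw [adjoin_eq_top]; trivial
  induction hx using Algebra.adjoin_induction with
  | mem x hx =>
    simp only [Set.mem_insert_iff, Set.mem_singleton_iff] at hx
    rcases hx with rfl | rfl | rfl | rfl <;> assumption
  | algebraMap r => exact hscalar r
  | add x y _ _ h1 h2 => exact hadd x y h1 h2
  | mul x y _ _ h1 h2 => exact hmul x y h1 h2

theorem isSUqQuadruple_coproduct (q : Set.Ioo (0 : ℝ) 1) :
    IsSUqQuadruple q (a q ⊗ₜ[ℂ] a q - qC q • (cS q ⊗ₜ[ℂ] c q))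
      (aS q ⊗ₜ[ℂ] aS q - qC q • (c q ⊗ₜ[ℂ] cS q))
      (c q ⊗ₜ[ℂ] a q + aS q ⊗ₜ[ℂ] c q) (a q ⊗ₜ[ℂ] cS q + cS q ⊗ₜ[ℂ] aS q) := by
  have h := isSUqQuadruple q
  have h1 : aS q * a q = 1 - c q * cS q := by rw [← h.aS_a, h.c_cS]; abel
  have h2 : a q * aS q = 1 - qC q ^ 2 • (c q * cS q) := by rw [← h.a_aS]; abel
  constructor <;>
  simp only [mul_add, add_mul, mul_sub, sub_mul, Algebra.TensorProduct.tmul_mul_tmul,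
    smul_mul_assoc, mul_smul_comm, h.a_c, h.a_cS, h.cS_aS, h.c_aS, ← h.c_cS, h1, h2,
    TensorProduct.tmul_sub, TensorProduct.sub_tmul, TensorProduct.tmul_smul,
    ← TensorProduct.smul_tmul', Algebra.TensorProduct.one_def] <;>
  module

/-- The coproduct `Δ` of `A(SU_q(2))`:
`Δ a = a ⊗ a - q c⋆ ⊗ c`, `Δ c = c ⊗ a + a⋆ ⊗ c` and the adjoint formulas. -/
def coproduct (q : Set.Ioo (0 : ℝ) 1) : SUq q →ₐ[ℂ] SUq q ⊗[ℂ] SUq q :=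
  lift q (isSUqQuadruple_coproduct q)

end SUq

open SUq

/-- `q^{1/2}` as a complex number. -/
def qHalf (q : Set.Ioo (0 : ℝ) 1) : ℂ := ((Real.sqrt (q : ℝ) : ℝ) : ℂ)

theorem qHalf_ne_zero (q : Set.Ioo (0 : ℝ) 1) : qHalf q ≠ 0 := by
  have := Real.sqrt_pos.2 q.2.1
  exact Complex.ofReal_ne_zero.2 this.ne'

theorem qHalf_sq (q : Set.Ioo (0 : ℝ) 1) : qHalf q ^ 2 = qC q := by
  rw [qHalf, qC, ← Complex.ofReal_pow, Real.sq_sqrt q.2.1.le]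

theorem qC_ne_zero (q : Set.Ioo (0 : ℝ) 1) : qC q ≠ 0 := Complex.ofReal_ne_zero.2 q.2.1.ne'

theorem isSUqQuadruple_diag (q : Set.Ioo (0 : ℝ) 1) {S : Type*} [CommRing S] [Algebra ℂ S]
    {u v : S} (h : u * v = 1) : IsSUqQuadruple q u v 0 0 := by
  constructor <;> simp [h, mul_comm v u]

/-- The pairing with the group-like element `K`, a character of `A(SU_q(2))`:
`⟨K, a⟩ = q^{-1/2}`, `⟨K, a⋆⟩ = q^{1/2}`, `⟨K, c⟩ = ⟨K, c⋆⟩ = 0`. -/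
def pairK (q : Set.Ioo (0 : ℝ) 1) : SUq q →ₐ[ℂ] ℂ :=
  lift q (isSUqQuadruple_diag q (inv_mul_cancel₀ (qHalf_ne_zero q)))

/-- The pairing with `K⁻¹`. -/
def pairKinv (q : Set.Ioo (0 : ℝ) 1) : SUq q →ₐ[ℂ] ℂ :=
  lift q (isSUqQuadruple_diag q (mul_inv_cancel₀ (qHalf_ne_zero q)))

theorem isSUqQuadruple_E (q : Set.Ioo (0 : ℝ) 1) :
    IsSUqQuadruple q !![qHalf q, 0; 0, (qHalf q)⁻¹] !![(qHalf q)⁻¹, 0; 0, qHalf q]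
      !![0, 1; 0, 0] (0 : Matrix (Fin 2) (Fin 2) ℂ) := by
  have h := qHalf_ne_zero q
  constructor <;> ext i j <;> fin_cases i <;> fin_cases j <;>
    simp [Matrix.mul_apply, Fin.sum_univ_two, ← qHalf_sq, h] <;> field_simp

theorem isSUqQuadruple_F (q : Set.Ioo (0 : ℝ) 1) :
    IsSUqQuadruple q !![qHalf q, 0; 0, (qHalf q)⁻¹] !![(qHalf q)⁻¹, 0; 0, qHalf q]
      (0 : Matrix (Fin 2) (Fin 2) ℂ) !![0, -(qC q)⁻¹; 0, 0] := by
  have h := qHalf_ne_zero q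
  constructor <;> ext i j <;> fin_cases i <;> fin_cases j <;>
    simp [Matrix.mul_apply, Fin.sum_univ_two, ← qHalf_sq, h] <;> field_simp

/-- The algebra homomorphism `x ↦ (⟨K⁻¹, x⟩, ⟨E, x⟩; 0, ⟨K, x⟩)`. -/
def matE (q : Set.Ioo (0 : ℝ) 1) : SUq q →ₐ[ℂ] Matrix (Fin 2) (Fin 2) ℂ :=
  lift q (isSUqQuadruple_E q)

/-- The algebra homomorphism `x ↦ (⟨K⁻¹, x⟩, ⟨F, x⟩; 0, ⟨K, x⟩)`. -/
def matF (q : Set.Ioo (0 : ℝ) 1) : SUq q →ₐ[ℂ] Matrix (Fin 2) (Fin 2) ℂ :=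
  lift q (isSUqQuadruple_F q)

/-- The pairing with `E`: it is `1` on `c`, `0` on `a`, `a⋆`, `c⋆`, and
`⟨E, x y⟩ = ⟨E, x⟩ ⟨K, y⟩ + ⟨K⁻¹, x⟩ ⟨E, y⟩`, see `pairE_mul`. -/
def pairE (q : Set.Ioo (0 : ℝ) 1) : SUq q →ₗ[ℂ] ℂ :=
  (Matrix.entryLinearMap ℂ ℂ 0 1).comp (matE q).toLinearMap

/-- The pairing with `F`: it is `-q⁻¹` on `c⋆`, `0` on `a`, `a⋆`, `c`, and
`⟨F, x y⟩ = ⟨F, x⟩ ⟨K, y⟩ + ⟨K⁻¹, x⟩ ⟨F, y⟩`, see `pairF_mul`. -/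
def pairF (q : Set.Ioo (0 : ℝ) 1) : SUq q →ₗ[ℂ] ℂ :=
  (Matrix.entryLinearMap ℂ ℂ 0 1).comp (matF q).toLinearMap

theorem matE_entries (q : Set.Ioo (0 : ℝ) 1) (x : SUq q) :
    matE q x 0 0 = pairKinv q x ∧ matE q x 1 0 = 0 ∧ matE q x 1 1 = pairK q x := by
  induction x using SUq.induction with
  | hscalar r => simp [Matrix.algebraMap_matrix_apply]
  | ha => simp [matE, pairK, pairKinv]
  | haS => simp [matE, pairK, pairKinv]
  | hc => simp [matE, pairK, pairKinv]
  | hcS => simp [matE, pairK, pairKinv]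
  | hadd x y hx hy => simp [hx, hy]
  | hmul x y hx hy => simp [Matrix.mul_apply, Fin.sum_univ_two, hx, hy]

theorem matF_entries (q : Set.Ioo (0 : ℝ) 1) (x : SUq q) :
    matF q x 0 0 = pairKinv q x ∧ matF q x 1 0 = 0 ∧ matF q x 1 1 = pairK q x := by
  induction x using SUq.induction with
  | hscalar r => simp [Matrix.algebraMap_matrix_apply]
  | ha => simp [matF, pairK, pairKinv]
  | haS => simp [matF, pairK, pairKinv]
  | hc => simp [matF, pairK, pairKinv]
  | hcS => simp [matF, pairK, pairKinv]
  | hadd x y hx hy => simp [hx, hy]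
  | hmul x y hx hy => simp [Matrix.mul_apply, Fin.sum_univ_two, hx, hy]

theorem pairE_mul (q : Set.Ioo (0 : ℝ) 1) (x y : SUq q) :
    pairE q (x * y) = pairE q x * pairK q y + pairKinv q x * pairE q y := by
  have hx := matE_entries q x
  have hy := matE_entries q y
  simp [pairE, Matrix.mul_apply, Fin.sum_univ_two, hx, hy]
  ring

theorem pairF_mul (q : Set.Ioo (0 : ℝ) 1) (x y : SUq q) :
    pairF q (x * y) = pairF q x * pairK q y + pairKinv q x * pairF q y := by
  have hx := matF_entries q x
  have hy := matF_entries q y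
  simp [pairF, Matrix.mul_apply, Fin.sum_univ_two, hx, hy]
  ring

/-- The slice map `x ⊗ y ↦ f(y) x`. -/
def slice (q : Set.Ioo (0 : ℝ) 1) (f : SUq q →ₗ[ℂ] ℂ) : SUq q ⊗[ℂ] SUq q →ₗ[ℂ] SUq q :=
  (TensorProduct.rid ℂ (SUq q)).toLinearMap.comp (f.lTensor (SUq q))

/-- The left action `h ▷ x = x₍₁₎ ⟨h, x₍₂₎⟩` of a linear functional `f = ⟨h, ·⟩`. -/
def leftAct (q : Set.Ioo (0 : ℝ) 1) (f : SUq q →ₗ[ℂ] ℂ) : SUq q →ₗ[ℂ] SUq q :=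
  (slice q f).comp (coproduct q).toLinearMap

@[simp] theorem slice_tmul (q : Set.Ioo (0 : ℝ) 1) (f : SUq q →ₗ[ℂ] ℂ) (x y : SUq q) :
    slice q f (x ⊗ₜ y) = f y • x := by simp [slice]

theorem leftAct_mul (q : Set.Ioo (0 : ℝ) 1) {f g h g' h' : SUq q →ₗ[ℂ] ℂ}
    (H : ∀ x y, f (x * y) = g x * h y + g' x * h' y) (x y : SUq q) :
    leftAct q f (x * y) = leftAct q g x * leftAct q h y + leftAct q g' x * leftAct q h' y := by
  have key : ∀ u v : SUq q ⊗[ℂ] SUq q,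
      slice q f (u * v) = slice q g u * slice q h v + slice q g' u * slice q h' v := by
    intro u v
    induction u using TensorProduct.induction_on with
    | zero => simp
    | add u₁ u₂ h₁ h₂ => simp only [add_mul, map_add, h₁, h₂]; abel
    | tmul u₁ u₂ =>
      induction v using TensorProduct.induction_on with
      | zero => simp
      | add v₁ v₂ h₁ h₂ => simp only [mul_add, map_add, h₁, h₂]; abel
      | tmul v₁ v₂ =>
        simp only [Algebra.TensorProduct.tmul_mul_tmul, slice_tmul, H, smul_mul_smul_comm,
          add_smul]
  simpa [leftAct] using key (coproduct q x) (coproduct q y)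

/-- The operator `K ▷` on `A(SU_q(2))`. -/
def opK (q : Set.Ioo (0 : ℝ) 1) : SUq q →ₗ[ℂ] SUq q := leftAct q (pairK q).toLinearMap

/-- The operator `K⁻¹ ▷` on `A(SU_q(2))`. -/
def opKinv (q : Set.Ioo (0 : ℝ) 1) : SUq q →ₗ[ℂ] SUq q := leftAct q (pairKinv q).toLinearMap

/-- The operator `E ▷` on `A(SU_q(2))`. -/
def opE (q : Set.Ioo (0 : ℝ) 1) : SUq q →ₗ[ℂ] SUq q := leftAct q (pairE q)

/-- The operator `F ▷` on `A(SU_q(2))`. -/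
def opF (q : Set.Ioo (0 : ℝ) 1) : SUq q →ₗ[ℂ] SUq q := leftAct q (pairF q)

theorem opK_mul (q : Set.Ioo (0 : ℝ) 1) (x y : SUq q) : opK q (x * y) = opK q x * opK q y := by
  have := leftAct_mul q (f := (pairK q).toLinearMap) (g := (pairK q).toLinearMap)
    (h := (pairK q).toLinearMap) (g' := 0) (h' := 0) (by simp) x y
  simpa [opK, leftAct, slice] using this

theorem opKinv_mul (q : Set.Ioo (0 : ℝ) 1) (x y : SUq q) :
    opKinv q (x * y) = opKinv q x * opKinv q y := by
  have := leftAct_mul q (f := (pairKinv q).toLinearMap) (g := (pairKinv q).toLinearMap)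
    (h := (pairKinv q).toLinearMap) (g' := 0) (h' := 0) (by simp) x y
  simpa [opKinv, leftAct, slice] using this

theorem opE_mul (q : Set.Ioo (0 : ℝ) 1) (x y : SUq q) :
    opE q (x * y) = opE q x * opK q y + opKinv q x * opE q y :=
  leftAct_mul q (by simp [pairE_mul]) x y

theorem opF_mul (q : Set.Ioo (0 : ℝ) 1) (x y : SUq q) :
    opF q (x * y) = opF q x * opK q y + opKinv q x * opF q y :=
  leftAct_mul q (by simp [pairF_mul]) x y

theorem opK_gen (q : Set.Ioo (0 : ℝ) 1) :
    opK q (a q) = (qHalf q)⁻¹ • a q ∧ opK q (aS q) = qHalf q • aS q ∧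
    opK q (c q) = (qHalf q)⁻¹ • c q ∧ opK q (cS q) = qHalf q • cS q := by
  simp [opK, leftAct, coproduct, pairK]

theorem opKinv_gen (q : Set.Ioo (0 : ℝ) 1) :
    opKinv q (a q) = qHalf q • a q ∧ opKinv q (aS q) = (qHalf q)⁻¹ • aS q ∧
    opKinv q (c q) = qHalf q • c q ∧ opKinv q (cS q) = (qHalf q)⁻¹ • cS q := by
  simp [opKinv, leftAct, coproduct, pairKinv]

theorem opE_gen (q : Set.Ioo (0 : ℝ) 1) :
    opE q (a q) = -(qC q • cS q) ∧ opE q (aS q) = 0 ∧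
    opE q (c q) = aS q ∧ opE q (cS q) = 0 := by
  simp [opE, leftAct, coproduct, pairE, matE]

theorem opF_gen (q : Set.Ioo (0 : ℝ) 1) :
    opF q (a q) = 0 ∧ opF q (aS q) = c q ∧
    opF q (c q) = 0 ∧ opF q (cS q) = -((qC q)⁻¹ • a q) := by
  simp [opF, leftAct, coproduct, pairF, matF, qC_ne_zero]

theorem opK_algebraMap (q : Set.Ioo (0 : ℝ) 1) (r : ℂ) :
    opK q (algebraMap ℂ _ r) = algebraMap ℂ _ r := by
  simp [opK, leftAct, Algebra.TensorProduct.algebraMap_apply]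

theorem opKinv_algebraMap (q : Set.Ioo (0 : ℝ) 1) (r : ℂ) :
    opKinv q (algebraMap ℂ _ r) = algebraMap ℂ _ r := by
  simp [opKinv, leftAct, Algebra.TensorProduct.algebraMap_apply]

theorem opKinv_opK (q : Set.Ioo (0 : ℝ) 1) (x : SUq q) : opKinv q (opK q x) = x := by
  have h := qHalf_ne_zero q
  induction x using SUq.induction with
  | hscalar r => rw [opK_algebraMap, opKinv_algebraMap]
  | ha => simp [opK_gen, opKinv_gen, smul_smul, h]
  | haS => simp [opK_gen, opKinv_gen, smul_smul, h]
  | hc => simp [opK_gen, opKinv_gen, smul_smul, h]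
  | hcS => simp [opK_gen, opKinv_gen, smul_smul, h]
  | hadd x y hx hy => simp [hx, hy]
  | hmul x y hx hy => simp [opK_mul, opKinv_mul, hx, hy]

/-- The left-invariant one-forms `ω_z`, `ω_-`, `ω_+` of the three-dimensional calculus. -/
inductive Dir : Type
  | z | minus | plus
  deriving DecidableEq

/-- The quantum tangent space: `X_z = (1 - K⁴) / (1 - q⁻²)`, `X_- = q^{-1/2} F K`,
`X_+ = q^{1/2} E K`, acting from the left on `A(SU_q(2))`. -/
def vf (q : Set.Ioo (0 : ℝ) 1) : Dir → SUq q →ₗ[ℂ] SUq q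
  | Dir.z => (1 - qC q ^ (-2 : ℤ))⁻¹ • (LinearMap.id - (opK q) ^ 4)
  | Dir.minus => (qHalf q)⁻¹ • (opF q).comp (opK q)
  | Dir.plus => qHalf q • (opE q).comp (opK q)

/-- The exponent in the commutation rule `ω_i x = (K^{wt i} ▷ x) ω_i`. -/
def wt : Dir → ℕ
  | Dir.z => 4
  | Dir.minus => 2
  | Dir.plus => 2

theorem opK_pow_mul (q : Set.Ioo (0 : ℝ) 1) (k : ℕ) (x y : SUq q) :
    (opK q ^ k) (x * y) = (opK q ^ k) x * (opK q ^ k) y := by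
  induction k with
  | zero => simp
  | succ k ih => simp only [pow_succ', Module.End.mul_apply, ih, opK_mul]

theorem opK_pow_one (q : Set.Ioo (0 : ℝ) 1) (k : ℕ) : (opK q ^ k) 1 = 1 := by
  have h1 : opK q 1 = 1 := by simpa using opK_algebraMap q 1
  induction k with
  | zero => simp
  | succ k ih => simp only [pow_succ', Module.End.mul_apply, ih, h1]

theorem vf_mul (q : Set.Ioo (0 : ℝ) 1) (i : Dir) (x y : SUq q) :
    vf q i (x * y) = vf q i x * (opK q ^ wt i) y + x * vf q i y := by
  cases i with
  | z =>
    simp only [vf, wt, LinearMap.smul_apply, LinearMap.sub_apply, LinearMap.id_apply,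
      opK_pow_mul, smul_mul_assoc, mul_smul_comm, ← smul_add, sub_mul, mul_sub]
    congr 1; abel
  | minus =>
    simp only [vf, wt, LinearMap.smul_apply, LinearMap.comp_apply, opK_mul, opF_mul, opKinv_opK,
      smul_mul_assoc, mul_smul_comm, ← smul_add, pow_two, Module.End.mul_apply]
  | plus =>
    simp only [vf, wt, LinearMap.smul_apply, LinearMap.comp_apply, opK_mul, opE_mul, opKinv_opK,
      smul_mul_assoc, mul_smul_comm, ← smul_add, pow_two, Module.End.mul_apply]

/-- The coordinate algebra `A(U(1)) = ℂ[z, z⁻¹]` as a quotient of `A(SU_q(2))`: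
`a ↦ z`, `a⋆ ↦ z⁻¹`, `c, c⋆ ↦ 0`. -/
def projU1 (q : Set.Ioo (0 : ℝ) 1) : SUq q →ₐ[ℂ] LaurentPolynomial ℂ :=
  lift q (isSUqQuadruple_diag q (u := LaurentPolynomial.T 1) (v := LaurentPolynomial.T (-1))
    (by rw [← LaurentPolynomial.T_add]; simp))

/-- The right coaction `Δ_R = (id ⊗ π) ∘ Δ` of `A(U(1))`. -/
def coaction (q : Set.Ioo (0 : ℝ) 1) : SUq q →ₐ[ℂ] SUq q ⊗[ℂ] LaurentPolynomial ℂ :=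
  (Algebra.TensorProduct.map (AlgHom.id ℂ (SUq q)) (projU1 q)).comp (coproduct q)

/-- The coordinate algebra of the standard Podleś sphere: the coinvariants, that is the elements
`b` with `Δ_R b = b ⊗ 1`. -/
def Sphere (q : Set.Ioo (0 : ℝ) 1) : Subalgebra ℂ (SUq q) :=
  AlgHom.equalizer (coaction q) Algebra.TensorProduct.includeLeft

theorem mem_sphere {q : Set.Ioo (0 : ℝ) 1} {x : SUq q} :
    x ∈ Sphere q ↔ coaction q x = x ⊗ₜ 1 := Iff.rfl

/-- The character of `A(U(1))` through which the pairing with `K` factors. -/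
def charK (q : Set.Ioo (0 : ℝ) 1) : LaurentPolynomial ℂ →ₐ[ℂ] ℂ :=
  { LaurentPolynomial.eval₂ (RingHom.id ℂ) (Units.mk0 (qHalf q) (qHalf_ne_zero q))⁻¹ with
    commutes' := fun r => by
      change LaurentPolynomial.eval₂ _ _ (LaurentPolynomial.C r) = _
      simp }

theorem charK_T (q : Set.Ioo (0 : ℝ) 1) (k : ℤ) :
    charK q (LaurentPolynomial.T k) = (qHalf q)⁻¹ ^ k := by
  change LaurentPolynomial.eval₂ _ _ (LaurentPolynomial.T k) = _
  rw [LaurentPolynomial.eval₂_T]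
  simp

theorem charK_comp (q : Set.Ioo (0 : ℝ) 1) : (charK q).comp (projU1 q) = pairK q := by
  apply SUq.algHom_ext <;> simp [projU1, pairK, charK_T]

theorem opK_eq_coaction (q : Set.Ioo (0 : ℝ) 1) (x : SUq q) :
    opK q x = TensorProduct.rid ℂ (SUq q)
      ((charK q).toLinearMap.lTensor (SUq q) (coaction q x)) := by
  have key : ∀ u : SUq q ⊗[ℂ] SUq q, slice q (pairK q).toLinearMap u =
      TensorProduct.rid ℂ (SUq q) ((charK q).toLinearMap.lTensor (SUq q)
        (Algebra.TensorProduct.map (AlgHom.id ℂ (SUq q)) (projU1 q) u)) := by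
    intro u
    induction u using TensorProduct.induction_on with
    | zero => simp
    | add u v hu hv => simp only [map_add, hu, hv]
    | tmul u v => simp [← charK_comp]
  exact key (coproduct q x)

/-- `K` acts trivially on the sphere. -/
theorem opK_sphere {q : Set.Ioo (0 : ℝ) 1} {b : SUq q} (hb : b ∈ Sphere q) : opK q b = b := by
  rw [opK_eq_coaction, mem_sphere.1 hb]; simp

theorem opK_pow_sphere {q : Set.Ioo (0 : ℝ) 1} {b : SUq q} (hb : b ∈ Sphere q) (k : ℕ) :
    (opK q ^ k) b = b := by
  induction k with
  | zero => simp
  | succ k ih => rw [pow_succ', Module.End.mul_apply, ih, opK_sphere hb]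

/-- The line bundle `L_n = {x | K ▷ x = q^{n/2} x}`, a left module over the sphere. -/
def LineBundle (q : Set.Ioo (0 : ℝ) 1) (n : ℤ) : Submodule (Sphere q) (SUq q) where
  carrier := {x | opK q x = (((q : ℝ) ^ ((n : ℝ) / 2) : ℝ) : ℂ) • x}
  add_mem' := by
    intro x y hx hy
    simp only [Set.mem_ofPred_eq] at *
    rw [map_add, hx, hy, smul_add]
  zero_mem' := by simp
  smul_mem' := by
    intro b x hx
    simp only [Set.mem_ofPred_eq] at *
    rw [Subalgebra.smul_def, smul_eq_mul, opK_mul, opK_sphere b.2, hx, mul_smul_comm]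

/-- The `A(SU_q(2))`-bimodule of one-forms of the three-dimensional left-covariant calculus on
`SU_q(2)`. It is the free left module with basis `ω_z, ω_-, ω_+`; an element is given by its
coefficients. -/
def Omega (q : Set.Ioo (0 : ℝ) 1) : Type := Dir → SUq q

namespace Omega

instance (q : Set.Ioo (0 : ℝ) 1) : AddCommGroup (Omega q) :=
  inferInstanceAs (AddCommGroup (Dir → SUq q))

instance (q : Set.Ioo (0 : ℝ) 1) : Module (SUq q) (Omega q) :=
  inferInstanceAs (Module (SUq q) (Dir → SUq q))

/-- The coefficient of `ω_i` in a one-form. -/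
def coeff {q : Set.Ioo (0 : ℝ) 1} (α : Omega q) (i : Dir) : SUq q := α i

@[ext] theorem ext {q : Set.Ioo (0 : ℝ) 1} {α β : Omega q} (h : ∀ i, coeff α i = coeff β i) :
    α = β := funext h

/-- The left-invariant one-form `ω_i`. -/
def omega (q : Set.Ioo (0 : ℝ) 1) (i : Dir) : Omega q := fun j => if j = i then 1 else 0

/-- The right module structure, determined by `ω_i x = (K^{wt i} ▷ x) ω_i`. -/
instance (q : Set.Ioo (0 : ℝ) 1) : Module (SUq q)ᵐᵒᵖ (Omega q) where
  smul x α := fun i => coeff α i * (opK q ^ wt i) x.unop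
  one_smul α := funext fun i => by
    change coeff α i * (opK q ^ wt i) 1 = _
    rw [opK_pow_one, mul_one]; rfl
  mul_smul x y α := funext fun i => by
    change coeff α i * (opK q ^ wt i) (y.unop * x.unop) =
      coeff α i * (opK q ^ wt i) y.unop * (opK q ^ wt i) x.unop
    rw [opK_pow_mul, mul_assoc]
  smul_zero x := funext fun i => zero_mul ((opK q ^ wt i) x.unop)
  smul_add x α β := funext fun i => add_mul (coeff α i) (coeff β i) ((opK q ^ wt i) x.unop)
  add_smul x y α := funext fun i => by
    change coeff α i * (opK q ^ wt i) (x.unop + y.unop) =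
      coeff α i * (opK q ^ wt i) x.unop + coeff α i * (opK q ^ wt i) y.unop
    rw [map_add, mul_add]
  zero_smul α := funext fun i => by
    change coeff α i * (opK q ^ wt i) 0 = 0
    rw [map_zero, mul_zero]

variable {q : Set.Ioo (0 : ℝ) 1}

@[simp] theorem coeff_add (α β : Omega q) (i : Dir) :
    coeff (α + β) i = coeff α i + coeff β i := rfl
@[simp] theorem coeff_sub (α β : Omega q) (i : Dir) :
    coeff (α - β) i = coeff α i - coeff β i := rfl
@[simp] theorem coeff_zero (i : Dir) : coeff (0 : Omega q) i = 0 := rfl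
@[simp] theorem coeff_smul (x : SUq q) (α : Omega q) (i : Dir) :
    coeff (x • α) i = x * coeff α i := rfl
@[simp] theorem coeff_op_smul (x : SUq q) (α : Omega q) (i : Dir) :
    coeff (MulOpposite.op x • α) i = coeff α i * (opK q ^ wt i) x := rfl

instance (q : Set.Ioo (0 : ℝ) 1) : SMulCommClass (SUq q) (SUq q)ᵐᵒᵖ (Omega q) where
  smul_comm x y α := by
    obtain ⟨y, rfl⟩ := MulOpposite.op_surjective y
    ext i; simp [mul_assoc]

end Omega

open Omega

/-- The exterior derivative `d x = (X_+ ▷ x) ω_+ + (X_- ▷ x) ω_- + (X_z ▷ x) ω_z`. -/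
def d (q : Set.Ioo (0 : ℝ) 1) (x : SUq q) : Omega q := fun i => vf q i x

@[simp] theorem coeff_d {q : Set.Ioo (0 : ℝ) 1} (x : SUq q) (i : Dir) :
    coeff (d q x) i = vf q i x := rfl

/-- The Leibniz rule `d (x y) = (d x) y + x (d y)`. -/
theorem d_mul {q : Set.Ioo (0 : ℝ) 1} (x y : SUq q) :
    d q (x * y) = MulOpposite.op y • d q x + x • d q y := by
  ext i; simp [vf_mul]

/-- The connection: the left-linear projection `Π_z` onto vertical forms with `Π_z ω_z = ω_z`,
`Π_z ω_± = 0`. -/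
def vertProj (q : Set.Ioo (0 : ℝ) 1) : Omega q →ₗ[SUq q] Omega q where
  toFun α := coeff α Dir.z • omega q Dir.z
  map_add' α β := by rw [coeff_add, add_smul]
  map_smul' x α := by rw [coeff_smul, mul_smul]; rfl

/-- The monopole covariant derivative `∇ = (id - Π_z) ∘ d`, as a map to one-forms on
`SU_q(2)`. -/
def covDeriv (q : Set.Ioo (0 : ℝ) 1) (φ : SUq q) : Omega q := d q φ - vertProj q (d q φ)

/-- The one-forms on the sphere: the restriction `B dB` to `B = A(S²_q)` of the calculus on
`SU_q(2)`. -/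
def OmegaSphere (q : Set.Ioo (0 : ℝ) 1) : Submodule (Sphere q) (Omega q) :=
  Submodule.span (Sphere q) {α | ∃ b ∈ Sphere q, α = d q b}

theorem op_smul_mem_omegaSphere {q : Set.Ioo (0 : ℝ) 1} {α : Omega q} (hα : α ∈ OmegaSphere q)
    {b : SUq q} (hb : b ∈ Sphere q) : MulOpposite.op b • α ∈ OmegaSphere q := by
  induction hα using Submodule.span_induction with
  | mem α h =>
    obtain ⟨x, hx, rfl⟩ := h
    have e : MulOpposite.op b • d q x = d q (x * b) - (⟨x, hx⟩ : Sphere q) • d q b := by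
      rw [d_mul]; exact (add_sub_cancel_right _ _).symm
    rw [e]
    exact Submodule.sub_mem _ (Submodule.subset_span ⟨_, mul_mem hx hb, rfl⟩)
      (Submodule.smul_mem _ _ (Submodule.subset_span ⟨_, hb, rfl⟩))
  | zero => rw [smul_zero]; exact Submodule.zero_mem _
  | add α β _ _ h₁ h₂ => rw [smul_add]; exact Submodule.add_mem _ h₁ h₂
  | smul x α _ h =>
    have e : MulOpposite.op b • x • α = x • MulOpposite.op b • α :=
      (smul_comm (x : SUq q) (MulOpposite.op b) α).symm
    rw [e]; exact Submodule.smul_mem _ _ h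

/-- The right module structure of the one-forms on the sphere. -/
instance (q : Set.Ioo (0 : ℝ) 1) : Module (Sphere q)ᵐᵒᵖ (OmegaSphere q) where
  smul b α := ⟨MulOpposite.op (b.unop : SUq q) • (α : Omega q),
    op_smul_mem_omegaSphere α.2 b.unop.2⟩
  one_smul α := Subtype.ext (one_smul (SUq q)ᵐᵒᵖ (α : Omega q))
  mul_smul x y α := Subtype.ext
    (mul_smul (MulOpposite.op (x.unop : SUq q)) (MulOpposite.op (y.unop : SUq q)) (α : Omega q))
  smul_zero x := Subtype.ext (smul_zero (MulOpposite.op (x.unop : SUq q)))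
  smul_add x α β := Subtype.ext
    (smul_add (MulOpposite.op (x.unop : SUq q)) (α : Omega q) (β : Omega q))
  add_smul x y α := Subtype.ext
    (add_smul (MulOpposite.op (x.unop : SUq q)) (MulOpposite.op (y.unop : SUq q)) (α : Omega q))
  zero_smul α := Subtype.ext (zero_smul (SUq q)ᵐᵒᵖ (α : Omega q))

/-- The exterior derivative of the sphere, as a map `B → Ω¹(S²_q)`. -/
def dSphere (q : Set.Ioo (0 : ℝ) 1) (b : Sphere q) : OmegaSphere q :=
  ⟨d q (b : SUq q), Submodule.subset_span ⟨b, b.2, rfl⟩⟩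

section Balanced

/-- The tensor product `M ⊗_R N` of a right module and a left module over a (noncommutative)
ring, as a quotient of the tensor product of abelian groups. -/
def BalancedTensor (R M N : Type*) [Ring R] [AddCommGroup M] [Module Rᵐᵒᵖ M] [AddCommGroup N]
    [Module R N] : Type _ :=
  (M ⊗[ℤ] N) ⧸ AddSubgroup.closure
    {t : M ⊗[ℤ] N | ∃ (r : R) (m : M) (x : N), t = (MulOpposite.op r • m) ⊗ₜ x - m ⊗ₜ (r • x)}

variable {R M N N' : Type*} [Ring R] [AddCommGroup M] [Module Rᵐᵒᵖ M] [AddCommGroup N]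
  [Module R N] [AddCommGroup N'] [Module R N']

instance : AddCommGroup (BalancedTensor R M N) :=
  inferInstanceAs (AddCommGroup ((M ⊗[ℤ] N) ⧸ AddSubgroup.closure
    {t : M ⊗[ℤ] N | ∃ (r : R) (m : M) (x : N), t = (MulOpposite.op r • m) ⊗ₜ x - m ⊗ₜ (r • x)}))

/-- The pure tensor `m ⊗ x` in `M ⊗_R N`. -/
def BalancedTensor.mk (R : Type*) {M N : Type*} [Ring R] [AddCommGroup M] [Module Rᵐᵒᵖ M]
    [AddCommGroup N] [Module R N] (m : M) (x : N) : BalancedTensor R M N :=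
  QuotientAddGroup.mk (m ⊗ₜ[ℤ] x)

theorem BalancedTensor.mk_op_smul (r : R) (m : M) (x : N) :
    BalancedTensor.mk R (MulOpposite.op r • m) x = BalancedTensor.mk R m (r • x) := by
  refine (QuotientAddGroup.eq_iff_sub_mem).2 (AddSubgroup.subset_closure ⟨r, m, x, rfl⟩)

/-- The universal property of `M ⊗_R N`. -/
def BalancedTensor.lift {P : Type*} [AddCommGroup P] (f : M →+ N →+ P)
    (hf : ∀ (r : R) (m : M) (x : N), f (MulOpposite.op r • m) x = f m (r • x)) :
    BalancedTensor R M N →+ P :=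
  QuotientAddGroup.lift _ (TensorProduct.liftAddHom f (by simp)) (by
    rw [AddSubgroup.closure_le]
    rintro _ ⟨r, m, x, rfl⟩
    simp [hf])

@[simp] theorem BalancedTensor.lift_mk {P : Type*} [AddCommGroup P] (f : M →+ N →+ P)
    (hf : ∀ (r : R) (m : M) (x : N), f (MulOpposite.op r • m) x = f m (r • x)) (m : M) (x : N) :
    BalancedTensor.lift f hf (BalancedTensor.mk R m x) = f m x := rfl

/-- The map `id ⊗ g : M ⊗_R N → M ⊗_R N'` induced by a left-linear map `g`. -/
def BalancedTensor.map (M : Type*) [AddCommGroup M] [Module Rᵐᵒᵖ M] (g : N →ₗ[R] N') :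
    BalancedTensor R M N →+ BalancedTensor R M N' :=
  BalancedTensor.lift
    (AddMonoidHom.mk' (fun m => AddMonoidHom.mk' (fun x => BalancedTensor.mk R m (g x))
      (fun x y => by rw [map_add, BalancedTensor.mk, TensorProduct.tmul_add]; rfl))
      (fun m m' => by
        ext x
        change BalancedTensor.mk R (m + m') (g x) = _
        rw [BalancedTensor.mk, TensorProduct.add_tmul]; rfl))
    (fun r m x => by
      change BalancedTensor.mk R (MulOpposite.op r • m) (g x) = BalancedTensor.mk R m (g (r • x))
      rw [map_smul, BalancedTensor.mk_op_smul])

@[simp] theorem BalancedTensor.map_mk (g : N →ₗ[R] N') (m : M) (x : N) :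
    BalancedTensor.map M g (BalancedTensor.mk R m x) = BalancedTensor.mk R m (g x) := rfl

@[elab_as_elim] theorem BalancedTensor.induction {P : BalancedTensor R M N → Prop} (h0 : P 0)
    (hmk : ∀ m x, P (BalancedTensor.mk R m x)) (hadd : ∀ s t, P s → P t → P (s + t))
    (t : BalancedTensor R M N) : P t := by
  obtain ⟨u, rfl⟩ := QuotientAddGroup.mk_surjective t
  induction u using TensorProduct.induction_on with
  | zero => exact h0
  | tmul m x => exact hmk m x
  | add u v hu hv => exact hadd _ _ hu hv

/-- The isomorphism `M ⊗_R N ≃ M ⊗_R N'` induced by an isomorphism `N ≃ N'` of left modules. -/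
def BalancedTensor.congr (M : Type*) [AddCommGroup M] [Module Rᵐᵒᵖ M] (e : N ≃ₗ[R] N') :
    BalancedTensor R M N ≃+ BalancedTensor R M N' where
  toFun := BalancedTensor.map M e.toLinearMap
  invFun := BalancedTensor.map M e.symm.toLinearMap
  left_inv t := by
    induction t using BalancedTensor.induction with
    | h0 => simp
    | hmk m x => simp
    | hadd s t hs ht => rw [map_add, map_add, hs, ht]
  right_inv t := by
    induction t using BalancedTensor.induction with
    | h0 => simp
    | hmk m x => simp
    | hadd s t hs ht => rw [map_add, map_add, hs, ht]
  map_add' := map_add _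

end Balanced

/-- The identification of `Ω¹(S²_q) ⊗_B L_n` with one-forms on `SU_q(2)`, `α ⊗ φ ↦ α φ`. -/
def formMul (q : Set.Ioo (0 : ℝ) 1) (n : ℤ) :
    BalancedTensor (Sphere q) (OmegaSphere q) (LineBundle q n) →+ Omega q :=
  BalancedTensor.lift
    (AddMonoidHom.mk' (fun α => AddMonoidHom.mk'
      (fun φ => MulOpposite.op (φ : SUq q) • (α : Omega q))
      (fun φ ψ => by rw [Submodule.coe_add, MulOpposite.op_add, add_smul]))
      (fun α β => by ext φ; simp))
    (fun b α φ => by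
      change MulOpposite.op (φ : SUq q) • MulOpposite.op (b : SUq q) • (α : Omega q) =
        MulOpposite.op ((b : SUq q) * (φ : SUq q)) • (α : Omega q)
      rw [MulOpposite.op_mul, mul_smul])

/-- The coefficient `β_{N,μ} = q^{2μ} ∏_{j<μ} (1 - q^{-2(N-j)}) / (1 - q^{-2(j+1)})`. -/
def betaCoeff (q : Set.Ioo (0 : ℝ) 1) (N μ : ℕ) : ℝ :=
  (q : ℝ) ^ (2 * μ) * ∏ j ∈ Finset.range μ,
    (1 - (q : ℝ) ^ (-(2 * ((N : ℤ) - (j : ℤ))))) / (1 - (q : ℝ) ^ (-(2 * ((j : ℤ) + 1))))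

/-- The coefficient `α_{N,μ} = ∏_{j<N-μ} (1 - q^{2(N-j)}) / (1 - q^{2(j+1)})`, for `μ ≤ N`. -/
def alphaCoeff (q : Set.Ioo (0 : ℝ) 1) (N μ : ℕ) : ℝ :=
  ∏ j ∈ Finset.range (N - μ),
    (1 - (q : ℝ) ^ (2 * ((N : ℤ) - (j : ℤ)))) / (1 - (q : ℝ) ^ (2 * ((j : ℤ) + 1)))

/-- The components of the vector `|Ψ^{(n)}⟩`, `μ = 0, …, |n|`: for `n ≥ 0` they are
`√β_{n,μ} c⋆^μ a⋆^{n-μ}`, for `n < 0` they are `√α_{|n|,μ} c^{|n|-μ} a^μ`. (For `n = 0` both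
formulas give `1`.) -/
def Psi (q : Set.Ioo (0 : ℝ) 1) (n : ℤ) (μ : Fin (n.natAbs + 1)) : SUq q :=
  if 0 ≤ n then
    ((Real.sqrt (betaCoeff q n.natAbs μ) : ℝ) : ℂ) •
      (cS q ^ (μ : ℕ) * aS q ^ (n.natAbs - (μ : ℕ)))
  else
    ((Real.sqrt (alphaCoeff q n.natAbs μ) : ℝ) : ℂ) •
      (c q ^ (n.natAbs - (μ : ℕ)) * a q ^ (μ : ℕ))

theorem coaction_gen (q : Set.Ioo (0 : ℝ) 1) :
    coaction q (a q) = a q ⊗ₜ LaurentPolynomial.T 1 ∧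
    coaction q (aS q) = aS q ⊗ₜ LaurentPolynomial.T (-1) ∧
    coaction q (c q) = c q ⊗ₜ LaurentPolynomial.T 1 ∧
    coaction q (cS q) = cS q ⊗ₜ LaurentPolynomial.T (-1) := by
  simp [coaction, coproduct, projU1]

theorem coaction_Psi (q : Set.Ioo (0 : ℝ) 1) (n : ℤ) (μ : Fin (n.natAbs + 1)) :
    coaction q (Psi q n μ) = Psi q n μ ⊗ₜ LaurentPolynomial.T (-n) := by
  have hμ : (μ : ℕ) ≤ n.natAbs := Nat.lt_succ_iff.1 μ.2
  unfold Psi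
  split_ifs with h
  · simp only [map_smul, map_mul, map_pow, coaction_gen, Algebra.TensorProduct.tmul_pow,
      Algebra.TensorProduct.tmul_mul_tmul, LaurentPolynomial.T_pow, ← LaurentPolynomial.T_add,
      TensorProduct.smul_tmul']
    congr 2; push_cast [hμ]; rw [abs_of_nonneg h]; ring
  · simp only [map_smul, map_mul, map_pow, coaction_gen, Algebra.TensorProduct.tmul_pow,
      Algebra.TensorProduct.tmul_mul_tmul, LaurentPolynomial.T_pow, ← LaurentPolynomial.T_add,
      TensorProduct.smul_tmul']
    congr 2; push_cast [hμ]; rw [abs_of_neg (not_le.1 h)]; ring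

theorem coaction_star_Psi (q : Set.Ioo (0 : ℝ) 1) (n : ℤ) (μ : Fin (n.natAbs + 1)) :
    coaction q (star (Psi q n μ)) = star (Psi q n μ) ⊗ₜ LaurentPolynomial.T n := by
  have hμ : (μ : ℕ) ≤ n.natAbs := Nat.lt_succ_iff.1 μ.2
  unfold Psi
  split_ifs with h
  · simp only [star_smul, star_mul, star_pow, star_aS, star_cS, map_smul, map_mul, map_pow,
      coaction_gen, Algebra.TensorProduct.tmul_pow,
      Algebra.TensorProduct.tmul_mul_tmul, LaurentPolynomial.T_pow, ← LaurentPolynomial.T_add,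
      TensorProduct.smul_tmul']
    congr 2; push_cast [hμ]; rw [abs_of_nonneg h]; ring
  · simp only [star_smul, star_mul, star_pow, star_a, star_c, map_smul, map_mul, map_pow,
      coaction_gen, Algebra.TensorProduct.tmul_pow,
      Algebra.TensorProduct.tmul_mul_tmul, LaurentPolynomial.T_pow, ← LaurentPolynomial.T_add,
      TensorProduct.smul_tmul']
    congr 2; push_cast [hμ]; rw [abs_of_neg (not_le.1 h)]; ring

/-- The projection `p^{(n)} = |Ψ^{(n)}⟩⟨Ψ^{(n)}|`, a matrix with entries in the sphere. -/
def projMatrix (q : Set.Ioo (0 : ℝ) 1) (n : ℤ) :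
    Matrix (Fin (n.natAbs + 1)) (Fin (n.natAbs + 1)) (Sphere q) := fun μ ν =>
  ⟨Psi q n μ * star (Psi q n ν), by
    rw [mem_sphere, map_mul, coaction_Psi, coaction_star_Psi,
      Algebra.TensorProduct.tmul_mul_tmul, ← LaurentPolynomial.T_add]
    simp⟩

/-- The left module of sections `E_n = B^{|n|+1} p^{(n)}`. -/
def Sections (q : Set.Ioo (0 : ℝ) 1) (n : ℤ) :
    Submodule (Sphere q) (Fin (n.natAbs + 1) → Sphere q) :=
  LinearMap.range (projMatrix q n).vecMulLinear

/-- The section `⟨f| p^{(n)}` of a row vector `⟨f|` over the sphere. -/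
def sectionOf (q : Set.Ioo (0 : ℝ) 1) (n : ℤ) (f : Fin (n.natAbs + 1) → Sphere q) :
    Sections q n :=
  ⟨(projMatrix q n).vecMulLinear f, LinearMap.mem_range_self _ f⟩

/-- The row `(p_{νμ})_μ` of the projection, as a section. -/
def rowSection (q : Set.Ioo (0 : ℝ) 1) (n : ℤ) (ν : Fin (n.natAbs + 1)) : Sections q n :=
  sectionOf q n (Pi.single ν 1)

/-- The Grassmann connection `σ ↦ (dσ) p^{(n)} = ∑_ν dσ_ν ⊗ p_{ν •}` of `E_n`, with values in
`Ω¹(S²_q) ⊗_B E_n`. -/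
def grassmann (q : Set.Ioo (0 : ℝ) 1) (n : ℤ) (s : Sections q n) :
    BalancedTensor (Sphere q) (OmegaSphere q) (Sections q n) :=
  ∑ ν, BalancedTensor.mk (Sphere q) (dSphere q ((s : Fin (n.natAbs + 1) → Sphere q) ν))
    (rowSection q n ν)

end QuantumHopf
end

open QuantumHopf

/-! The proof rests on the identity `∑ μ, star Ψ_μ * Ψ_μ = 1` (`sum_star_Psi_mul_Psi`). It is a
noncommutative `p`-binomial theorem with `p = q^{∓2}`: the operators `w ↦ u w v` and `w ↦ y w`,
where `(u, v)` is `(a, a⋆)` or `(a⋆, a)` and `y` is a multiple of `c c⋆`, commute up to the factor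
`p`, and their sum fixes `1` (`sum_qBinom_mul`).

The elements `φ ∈ L_n` are exactly those with `Δ_R φ = φ ⊗ z^{-n}` (`mem_lineBundle_iff`): the
elements homogeneous for the coaction span the algebra, homogeneous elements of different degrees
are eigenvectors of `K` for different eigenvalues because `q` is not a root of unity, and eigenspaces
are independent. Hence `φ * star Ψ_μ` lies in the sphere, and the identity above shows that
`φ ↦ (φ * star Ψ_μ)_μ` and `s ↦ ∑ μ, s_μ * Ψ_μ` are mutually inverse. It also shows that every `t` in
`Ω¹(S²_q) ⊗_B L_n` equals `∑ μ, (t̄ · star Ψ_μ) ⊗ Ψ_μ`, where `t̄` is the form that `t` is mapped to,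
so the multiplication map is injective.

For the connection put `∇φ = ∑ ν, d(φ * star Ψ_ν) ⊗ Ψ_ν`. By the Leibniz rule it is mapped to
`dφ + φ ∑ ν, d(star Ψ_ν) Ψ_ν`. One of `X_±` annihilates all `Ψ_ν` and the other all `star Ψ_ν`, so,
again by the Leibniz rule and the identity, the sum has no component along `ω_±`; and the vertical
component of the whole vanishes because one-forms on the sphere have none. Therefore `∇φ` is mapped
to `(id - Π_z) dφ` (`sum_d_mul_Psi`), and `id ⊗ σ` takes it to the Grassmann connection because
`σ Ψ_ν` is the `ν`-th row of the projection. -/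

noncomputable section

namespace QuantumHopf

open SUq

/-! ### A noncommutative binomial theorem -/

/-- The Gaussian binomial coefficient `∏_{j<k} (1 - p^{N-j}) / (1 - p^{j+1})`, as a product of
quotients. The exponent `N - j` is an integer, so that a factor vanishes for `k > N`. -/
def qBinom (p : ℝ) (N k : ℕ) : ℝ :=
  ∏ j ∈ Finset.range k, (1 - p ^ ((N : ℤ) - (j : ℤ))) / (1 - p ^ ((j : ℤ) + 1))

theorem qBinom_zero_right (p : ℝ) (N : ℕ) : qBinom p N 0 = 1 := by simp [qBinom]

theorem qBinom_self_succ (p : ℝ) (N : ℕ) : qBinom p N (N + 1) = 0 := by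
  simp [qBinom, Finset.prod_range_succ]

theorem qBinom_succ_right (p : ℝ) (N k : ℕ) :
    qBinom p N (k + 1) =
      qBinom p N k * ((1 - p ^ ((N : ℤ) - (k : ℤ))) / (1 - p ^ ((k : ℤ) + 1))) := by
  rw [qBinom, qBinom, Finset.prod_range_succ]

theorem qBinom_succ_succ_eq_mul (p : ℝ) (N k : ℕ) :
    qBinom p (N + 1) (k + 1) =
      qBinom p N k * ((1 - p ^ ((N : ℤ) + 1)) / (1 - p ^ ((k : ℤ) + 1))) := by
  unfold qBinom
  simp only [Finset.prod_div_distrib]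
  rw [Finset.prod_range_succ' (fun j : ℕ => 1 - p ^ (((N + 1 : ℕ) : ℤ) - (j : ℤ))),
    Finset.prod_range_succ (fun j : ℕ => 1 - p ^ ((j : ℤ) + 1))]
  have h : ∀ j : ℕ, ((N + 1 : ℕ) : ℤ) - ((j + 1 : ℕ) : ℤ) = (N : ℤ) - j := by
    intro j; push_cast; ring
  simp only [h]
  rw [mul_div_mul_comm]
  simp

theorem qBinom_succ_succ {p : ℝ} (hp0 : p ≠ 0) (hp : ∀ k : ℕ, 1 - p ^ ((k : ℤ) + 1) ≠ 0)
    {N k : ℕ} (hk : k ≤ N) :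
    qBinom p (N + 1) (k + 1) = qBinom p N (k + 1) + p ^ (N - k) * qBinom p N k := by
  rw [qBinom_succ_succ_eq_mul, qBinom_succ_right]
  have h1 := hp k
  have e : p ^ ((N : ℤ) + 1) = p ^ ((N : ℤ) - k) * p ^ ((k : ℤ) + 1) := by
    rw [← zpow_add₀ hp0]; congr 1; ring
  have e' : p ^ (N - k) = p ^ ((N : ℤ) - k) := by
    rw [← zpow_natCast]; push_cast [hk]; rfl
  rw [e, e']
  field_simp
  ring

/-- If `u v + y = 1` and `y u = p u y`, then `w ↦ u w v` and `w ↦ y w` satisfy the relation of the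
`p`-binomial theorem and their sum fixes `1`; this is the expansion of its `N`-th power at `1`. -/
theorem sum_qBinom_mul {S : Type*} [Ring S] [Algebra ℂ S] {p : ℝ} (hp0 : p ≠ 0)
    (hp : ∀ k : ℕ, 1 - p ^ ((k : ℤ) + 1) ≠ 0) {u v y : S} (h1 : u * v + y = 1)
    (hyu : y * u = (p : ℂ) • (u * y)) (N : ℕ) :
    ∑ k ∈ Finset.range (N + 1), (qBinom p N k : ℂ) • (u ^ (N - k) * y ^ k * v ^ (N - k)) = 1 := by
  have hyu' : ∀ m : ℕ, y * u ^ m = (p : ℂ) ^ m • (u ^ m * y) := by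
    intro m
    induction m with
    | zero => simp
    | succ m ih =>
      rw [pow_succ, ← mul_assoc, ih, smul_mul_assoc, mul_assoc, hyu, mul_smul_comm, smul_smul,
        ← pow_succ, mul_assoc]
  induction N with
  | zero => simp [qBinom]
  | succ N ih =>
    have key : u * (∑ k ∈ Finset.range (N + 1),
          (qBinom p N k : ℂ) • (u ^ (N - k) * y ^ k * v ^ (N - k))) * v +
        y * ∑ k ∈ Finset.range (N + 1),
          (qBinom p N k : ℂ) • (u ^ (N - k) * y ^ k * v ^ (N - k)) = 1 := by
      rw [ih, mul_one, mul_one, h1]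
    rw [← key, Finset.mul_sum, Finset.sum_mul, Finset.mul_sum]
    have hL : ∀ k ∈ Finset.range (N + 1),
        u * ((qBinom p N k : ℂ) • (u ^ (N - k) * y ^ k * v ^ (N - k))) * v =
          (qBinom p N k : ℂ) • (u ^ (N + 1 - k) * y ^ k * v ^ (N + 1 - k)) := by
      intro k hk
      have hk' : N + 1 - k = (N - k) + 1 := by have := Finset.mem_range.1 hk; omega
      rw [hk', pow_succ' u, pow_succ v]
      simp only [mul_smul_comm, smul_mul_assoc, mul_assoc]
    have hM : ∀ k ∈ Finset.range (N + 1),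
        y * ((qBinom p N k : ℂ) • (u ^ (N - k) * y ^ k * v ^ (N - k))) =
          ((p ^ (N - k) * qBinom p N k : ℝ) : ℂ) •
            (u ^ (N - k) * y ^ (k + 1) * v ^ (N - k)) := by
      intro k _
      rw [mul_smul_comm, mul_assoc, ← mul_assoc y, hyu', smul_mul_assoc, smul_smul, pow_succ' y]
      push_cast
      simp only [mul_assoc, mul_comm]
    rw [Finset.sum_congr rfl hL, Finset.sum_congr rfl hM,
      Finset.sum_range_succ' _ (N + 1),
      Finset.sum_range_succ' (fun k => (qBinom p N k : ℂ) • (u ^ (N + 1 - k) * y ^ k *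
        v ^ (N + 1 - k)))]
    -- the term `k = N + 1`, absent from the first sum, has coefficient zero
    have hext : ∑ k ∈ Finset.range N, (qBinom p N (k + 1) : ℂ) •
          (u ^ (N + 1 - (k + 1)) * y ^ (k + 1) * v ^ (N + 1 - (k + 1))) =
        ∑ k ∈ Finset.range (N + 1), (qBinom p N (k + 1) : ℂ) •
          (u ^ (N - k) * y ^ (k + 1) * v ^ (N - k)) := by
      rw [Finset.sum_range_succ, qBinom_self_succ]
      simp
    rw [hext, add_right_comm, ← Finset.sum_add_distrib]
    rw [qBinom_zero_right, qBinom_zero_right]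
    congr 1
    refine Finset.sum_congr rfl fun k hk => ?_
    rw [qBinom_succ_succ hp0 hp (Nat.lt_succ_iff.1 (Finset.mem_range.1 hk)), ← add_smul,
      Nat.add_sub_add_right]
    push_cast; rfl

/-! ### Normalisation of the vectors `Ψ` -/

variable {q : Set.Ioo (0 : ℝ) 1} {n : ℤ}

theorem betaCoeff_eq (q : Set.Ioo (0 : ℝ) 1) (N μ : ℕ) :
    betaCoeff q N μ = (q : ℝ) ^ (2 * μ) * qBinom ((q : ℝ) ^ (-2 : ℤ)) N μ := by
  simp only [betaCoeff, qBinom, ← zpow_mul, neg_mul]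

theorem alphaCoeff_eq (q : Set.Ioo (0 : ℝ) 1) (N μ : ℕ) :
    alphaCoeff q N μ = qBinom ((q : ℝ) ^ (2 : ℤ)) N (N - μ) := by
  simp only [alphaCoeff, qBinom, ← zpow_mul]

theorem betaCoeff_nonneg (q : Set.Ioo (0 : ℝ) 1) {N μ : ℕ} (h : μ ≤ N) :
    0 ≤ betaCoeff q N μ := by
  have hq := q.2.1
  refine mul_nonneg (pow_nonneg hq.le _) (Finset.prod_nonneg fun j hj => ?_)
  have hj' := Finset.mem_range.1 hj
  refine div_nonneg_of_nonpos ?_ ?_ <;>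
  exact sub_nonpos.2 (one_le_zpow_of_nonpos₀ hq q.2.2.le (by omega))

theorem alphaCoeff_nonneg (q : Set.Ioo (0 : ℝ) 1) (N μ : ℕ) :
    0 ≤ alphaCoeff q N μ := by
  have hq := q.2.1
  refine Finset.prod_nonneg fun j hj => ?_
  have hj' := Finset.mem_range.1 hj
  refine div_nonneg ?_ ?_ <;>
  exact sub_nonneg.2 (zpow_le_one₀ hq q.2.2.le (by omega))

theorem star_smul_mul_smul_sqrt {x y : SUq q} {r : ℝ} (hr : 0 ≤ r) (h : star x = y) :
    star (((Real.sqrt r : ℝ) : ℂ) • x) * (((Real.sqrt r : ℝ) : ℂ) • x) = (r : ℂ) • (y * x) := by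
  rw [star_smul, smul_mul_smul_comm, h]
  congr 1
  rw [Complex.star_def, Complex.conj_ofReal, ← Complex.ofReal_mul, Real.mul_self_sqrt hr]

theorem c_cS_mul_a (q : Set.Ioo (0 : ℝ) 1) :
    (c q * cS q) * a q = (qC q)⁻¹ ^ 2 • (a q * (c q * cS q)) := by
  have h := isSUqQuadruple q
  have hq := qC_ne_zero q
  rw [← mul_assoc (a q), h.a_c, smul_mul_assoc, mul_assoc (c q) (a q), h.a_cS, mul_smul_comm,
    smul_smul, smul_smul, mul_assoc]
  have : (qC q)⁻¹ ^ 2 * (qC q * qC q) = 1 := by field_simp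
  rw [mul_assoc ((qC q)⁻¹ ^ 2), this, one_smul]

theorem cS_c_mul_aS (q : Set.Ioo (0 : ℝ) 1) :
    (cS q * c q) * aS q = qC q ^ 2 • (aS q * (cS q * c q)) := by
  have h := isSUqQuadruple q
  rw [mul_assoc, h.c_aS, mul_smul_comm, ← mul_assoc, h.cS_aS, smul_mul_assoc, smul_smul, mul_assoc,
    pow_two]

/-- The vector `Ψ` is normalised. -/
theorem sum_star_Psi_mul_Psi (q : Set.Ioo (0 : ℝ) 1) (n : ℤ) :
    ∑ μ, star (Psi q n μ) * Psi q n μ = 1 := by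
  have h := isSUqQuadruple q
  have hq := q.2.1
  have hq1 := q.2.2
  unfold Psi
  split_ifs with hn
  · have hp0 : (q : ℝ) ^ (-2 : ℤ) ≠ 0 := (zpow_pos hq _).ne'
    have hp : ∀ k : ℕ, 1 - ((q : ℝ) ^ (-2 : ℤ)) ^ ((k : ℤ) + 1) ≠ 0 := by
      intro k
      rw [← zpow_mul]
      exact (sub_neg.2 (one_lt_zpow_of_neg₀ hq hq1 (by omega))).ne
    have key := sum_qBinom_mul hp0 hp (u := a q) (v := aS q) (y := qC q ^ 2 • (c q * cS q))
      h.a_aS (by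
        rw [smul_mul_assoc, c_cS_mul_a, mul_smul_comm, smul_comm]
        congr 1
        simp [qC]) n.natAbs
    rw [← key, ← Fin.sum_univ_eq_sum_range]
    refine Finset.sum_congr rfl fun μ _ => ?_
    rw [star_smul_mul_smul_sqrt (betaCoeff_nonneg q (Nat.lt_succ_iff.1 μ.2))
      (y := a q ^ (n.natAbs - (μ : ℕ)) * c q ^ (μ : ℕ)) (by simp), betaCoeff_eq, smul_pow,
      mul_smul_comm, smul_mul_assoc, smul_smul, (show Commute (c q) (cS q) from h.c_cS).mul_pow]
    simp only [mul_assoc]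
    congr 1
    push_cast
    rw [qC, ← pow_mul, mul_comm]
  · have hp0 : (q : ℝ) ^ (2 : ℤ) ≠ 0 := (zpow_pos hq _).ne'
    have hp : ∀ k : ℕ, 1 - ((q : ℝ) ^ (2 : ℤ)) ^ ((k : ℤ) + 1) ≠ 0 := by
      intro k
      rw [← zpow_mul]
      exact (sub_pos.2 (zpow_lt_one₀ hq hq1 (by omega))).ne'
    have key := sum_qBinom_mul hp0 hp (u := aS q) (v := a q) (y := cS q * c q)
      h.aS_a (by
        rw [cS_c_mul_aS]
        congr 1
        simp [qC]) n.natAbs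
    -- in this range of `n` the summation index of the binomial theorem is `|n| - μ`
    rw [← key, ← Finset.sum_range_reflect, ← Fin.sum_univ_eq_sum_range]
    refine Finset.sum_congr rfl fun μ _ => ?_
    have hμ : (μ : ℕ) ≤ n.natAbs := Nat.lt_succ_iff.1 μ.2
    rw [star_smul_mul_smul_sqrt (alphaCoeff_nonneg q _ _)
      (y := aS q ^ (μ : ℕ) * cS q ^ (n.natAbs - (μ : ℕ))) (by simp), alphaCoeff_eq,
      Nat.add_sub_cancel, Nat.sub_sub_self hμ,
      (show Commute (cS q) (c q) from h.c_cS.symm).mul_pow]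
    simp only [mul_assoc]

/-! ### Line bundles as weight spaces of the coaction -/

/-- The elements `x` of degree `k` for the coaction of `A(U(1))`: `Δ_R x = x ⊗ z^k`. -/
def weightSpace (q : Set.Ioo (0 : ℝ) 1) (k : ℤ) : Submodule ℂ (SUq q) where
  carrier := {x | coaction q x = x ⊗ₜ LaurentPolynomial.T k}
  add_mem' := by
    intro x y hx hy
    simp only [Set.mem_ofPred_eq] at *
    rw [map_add, hx, hy, TensorProduct.add_tmul]
  zero_mem' := by simp
  smul_mem' := by
    intro r x hx
    simp only [Set.mem_ofPred_eq] at *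
    rw [map_smul, hx, TensorProduct.smul_tmul']

theorem mem_weightSpace {k : ℤ} {x : SUq q} :
    x ∈ weightSpace q k ↔ coaction q x = x ⊗ₜ LaurentPolynomial.T k := Iff.rfl

theorem mul_mem_weightSpace {k l : ℤ} {x y : SUq q} (hx : x ∈ weightSpace q k)
    (hy : y ∈ weightSpace q l) : x * y ∈ weightSpace q (k + l) := by
  rw [mem_weightSpace] at *
  rw [map_mul, hx, hy, Algebra.TensorProduct.tmul_mul_tmul, LaurentPolynomial.T_add]

theorem mem_sphere_iff_weightSpace {x : SUq q} : x ∈ Sphere q ↔ x ∈ weightSpace q 0 := by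
  rw [mem_sphere, mem_weightSpace, LaurentPolynomial.T_zero]

theorem opK_weightSpace {k : ℤ} {x : SUq q} (hx : x ∈ weightSpace q k) :
    opK q x = (qHalf q)⁻¹ ^ k • x := by
  rw [opK_eq_coaction, mem_weightSpace.1 hx, LinearMap.lTensor_tmul, TensorProduct.rid_tmul]
  congr 1
  exact charK_T q k

theorem iSup_weightSpace (q : Set.Ioo (0 : ℝ) 1) : ⨆ k, weightSpace q k = ⊤ := by
  rw [eq_top_iff]
  intro x _
  have hle : ∀ (k : ℤ) {x : SUq q}, x ∈ weightSpace q k → x ∈ ⨆ k, weightSpace q k :=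
    fun k _ hx => Submodule.mem_iSup_of_mem k hx
  have hgen := coaction_gen q
  induction x using SUq.induction with
  | hscalar r =>
    refine hle 0 ?_
    rw [← mem_sphere_iff_weightSpace]
    exact (Sphere q).algebraMap_mem r
  | ha => exact hle _ hgen.1
  | haS => exact hle _ hgen.2.1
  | hc => exact hle _ hgen.2.2.1
  | hcS => exact hle _ hgen.2.2.2
  | hadd x y hx hy => exact add_mem (hx trivial) (hy trivial)
  | hmul x y hx hy =>
    refine Submodule.mul_le.1 (?_ : (⨆ k, weightSpace q k) * (⨆ k, weightSpace q k) ≤ _)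
      x (hx trivial) y (hy trivial)
    rw [Submodule.iSup_mul]
    refine iSup_le fun k => ?_
    rw [Submodule.mul_iSup]
    refine iSup_le fun l => Submodule.mul_le.2 fun x hx y hy => ?_
    exact hle _ (mul_mem_weightSpace hx hy)

theorem qHalf_inv_zpow_injective (q : Set.Ioo (0 : ℝ) 1) :
    Function.Injective fun k : ℤ => (qHalf q)⁻¹ ^ k := by
  have h0 : 0 < Real.sqrt (q : ℝ) := Real.sqrt_pos.2 q.2.1
  have h1 : Real.sqrt (q : ℝ) < 1 := by
    rw [Real.sqrt_lt' one_pos, one_pow]; exact q.2.2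
  intro k l hkl
  simp only [qHalf] at hkl
  norm_cast at hkl
  exact zpow_right_injective₀ (inv_pos.2 h0) (one_lt_inv₀ h0 |>.2 h1).ne' hkl

/-- The weight spaces are the eigenspaces of `K`: `q` is not a root of unity. -/
theorem mem_weightSpace_of_opK {k : ℤ} {x : SUq q} (hx : opK q x = (qHalf q)⁻¹ ^ k • x) :
    x ∈ weightSpace q k := by
  have hW : ∀ l, weightSpace q l ≤ Module.End.eigenspace (opK q) ((qHalf q)⁻¹ ^ l) :=
    fun l y hy => Module.End.mem_eigenspace_iff.2 (opK_weightSpace hy)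
  have hind : iSupIndep fun l : ℤ => Module.End.eigenspace (opK q) ((qHalf q)⁻¹ ^ l) :=
    (Module.End.eigenspaces_iSupIndep (opK q)).comp (qHalf_inv_zpow_injective q)
  have htop : weightSpace q k ⊔ ⨆ l, ⨆ _ : l ≠ k, weightSpace q l = ⊤ := by
    rw [← iSup_weightSpace q]
    refine le_antisymm (sup_le (le_iSup _ _) (iSup_le fun l => iSup_le fun _ => le_iSup _ _)) ?_
    refine iSup_le fun l => ?_
    by_cases hl : l = k
    · rw [hl]; exact le_sup_left
    · exact le_sup_of_le_right (le_iSup₂_of_le l hl le_rfl)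
  obtain ⟨y, hy, z, hz, rfl⟩ := Submodule.mem_sup.1 (htop ▸ Submodule.mem_top (x := x))
  have hz1 : z ∈ Module.End.eigenspace (opK q) ((qHalf q)⁻¹ ^ k) := by
    have := sub_mem (Module.End.mem_eigenspace_iff.2 hx) (hW k hy)
    rwa [add_sub_cancel_left] at this
  have hz2 : z ∈ ⨆ l, ⨆ _ : l ≠ k, Module.End.eigenspace (opK q) ((qHalf q)⁻¹ ^ l) :=
    (iSup₂_mono fun l _ => hW l) hz
  have hz0 : z = 0 := Submodule.disjoint_def.1 (hind k) z hz1 hz2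
  rwa [hz0, add_zero]

theorem ofReal_rpow_half (q : Set.Ioo (0 : ℝ) 1) (n : ℤ) :
    (((q : ℝ) ^ ((n : ℝ) / 2) : ℝ) : ℂ) = (qHalf q)⁻¹ ^ (-n) := by
  rw [qHalf, Real.sqrt_eq_rpow, inv_zpow', neg_neg, ← Complex.ofReal_zpow, ← Real.rpow_intCast,
    ← Real.rpow_mul q.2.1.le]
  congr 2; ring

theorem mem_lineBundle_iff {x : SUq q} : x ∈ LineBundle q n ↔ x ∈ weightSpace q (-n) := by
  have h : x ∈ LineBundle q n ↔ opK q x = (qHalf q)⁻¹ ^ (-n) • x := by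
    rw [← ofReal_rpow_half]; rfl
  rw [h]
  exact ⟨mem_weightSpace_of_opK, opK_weightSpace⟩

theorem Psi_mem_lineBundle (q : Set.Ioo (0 : ℝ) 1) (n : ℤ) (μ : Fin (n.natAbs + 1)) :
    Psi q n μ ∈ LineBundle q n := mem_lineBundle_iff.2 (coaction_Psi q n μ)

theorem mul_star_Psi_mem_sphere {φ : SUq q} (hφ : φ ∈ LineBundle q n)
    (μ : Fin (n.natAbs + 1)) : φ * star (Psi q n μ) ∈ Sphere q := by
  rw [mem_sphere_iff_weightSpace, ← neg_add_cancel n]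
  exact mul_mem_weightSpace (mem_lineBundle_iff.1 hφ) (coaction_star_Psi q n μ)

theorem sum_mul_star_Psi_mul_Psi (n : ℤ) (x : SUq q) :
    ∑ μ, x * star (Psi q n μ) * Psi q n μ = x := by
  simp only [mul_assoc, ← Finset.mul_sum, sum_star_Psi_mul_Psi, mul_one]

/-! ### The module of sections -/

theorem vecMul_projMatrix (f : Fin (n.natAbs + 1) → Sphere q) (ν : Fin (n.natAbs + 1)) :
    (((projMatrix q n).vecMulLinear f ν : Sphere q) : SUq q) =
      (∑ μ, (f μ : SUq q) * Psi q n μ) * star (Psi q n ν) := by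
  rw [Matrix.vecMulLinear_apply, Matrix.vecMul, dotProduct, AddSubmonoidClass.coe_finsetSum,
    Finset.sum_mul]
  refine Finset.sum_congr rfl fun μ _ => ?_
  rw [mul_assoc]; rfl

/-- The row `(φ Ψ_μ⋆)_μ` of a section `φ` of the line bundle. -/
def lineRow (q : Set.Ioo (0 : ℝ) 1) (n : ℤ) (φ : LineBundle q n) : Fin (n.natAbs + 1) → Sphere q :=
  fun μ => ⟨(φ : SUq q) * star (Psi q n μ), mul_star_Psi_mem_sphere φ.2 μ⟩

theorem vecMul_lineRow (φ : LineBundle q n) :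
    (projMatrix q n).vecMulLinear (lineRow q n φ) = lineRow q n φ := by
  funext ν
  refine Subtype.ext ((vecMul_projMatrix _ ν).trans ?_)
  simp only [lineRow, sum_mul_star_Psi_mul_Psi]

/-- The sum `∑ f_μ Ψ_μ`, as an element of the line bundle. -/
def rowPairing (q : Set.Ioo (0 : ℝ) 1) (n : ℤ) (f : Fin (n.natAbs + 1) → Sphere q) :
    LineBundle q n :=
  ∑ μ, f μ • ⟨Psi q n μ, Psi_mem_lineBundle q n μ⟩

theorem coe_rowPairing (f : Fin (n.natAbs + 1) → Sphere q) :
    (rowPairing q n f : SUq q) = ∑ μ, (f μ : SUq q) * Psi q n μ := by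
  rw [rowPairing, AddSubmonoidClass.coe_finsetSum]
  rfl

theorem rowPairing_lineRow (φ : LineBundle q n) : rowPairing q n (lineRow q n φ) = φ :=
  Subtype.ext ((coe_rowPairing _).trans (sum_mul_star_Psi_mul_Psi n _))

theorem lineRow_rowPairing (f : Fin (n.natAbs + 1) → Sphere q) :
    lineRow q n (rowPairing q n f) = (projMatrix q n).vecMulLinear f := by
  funext ν
  refine Subtype.ext (Eq.trans ?_ (vecMul_projMatrix f ν).symm)
  rw [← coe_rowPairing]; rfl

/-- The isomorphism `L_n ≃ E_n`, `φ ↦ (φ Ψ_μ⋆)_μ`, with inverse `s ↦ ∑ s_μ Ψ_μ`. -/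
def sectionEquiv (q : Set.Ioo (0 : ℝ) 1) (n : ℤ) : LineBundle q n ≃ₗ[Sphere q] Sections q n where
  toFun φ := ⟨lineRow q n φ, lineRow q n φ, vecMul_lineRow φ⟩
  map_add' φ ψ := Subtype.ext (funext fun _ => Subtype.ext (add_mul _ _ _))
  map_smul' b φ := Subtype.ext (funext fun _ => Subtype.ext (mul_assoc _ _ _))
  invFun s := rowPairing q n s
  left_inv φ := rowPairing_lineRow φ
  right_inv s := by
    obtain ⟨_, f, rfl⟩ := s
    refine Subtype.ext ?_
    change lineRow q n (rowPairing q n ((projMatrix q n).vecMulLinear f)) =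
      (projMatrix q n).vecMulLinear f
    rw [← lineRow_rowPairing f, rowPairing_lineRow]

theorem sectionEquiv_symm_sectionOf (f : Fin (n.natAbs + 1) → Sphere q) :
    (sectionEquiv q n).symm (sectionOf q n f) = rowPairing q n f := by
  rw [LinearEquiv.symm_apply_eq]
  exact Subtype.ext (lineRow_rowPairing f).symm

theorem sectionEquiv_Psi (ν : Fin (n.natAbs + 1)) :
    sectionEquiv q n ⟨Psi q n ν, Psi_mem_lineBundle q n ν⟩ = rowSection q n ν := by
  rw [rowSection, ← LinearEquiv.eq_symm_apply, sectionEquiv_symm_sectionOf, rowPairing]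
  rw [Finset.sum_eq_single ν]
  · rw [Pi.single_eq_same, one_smul]
  · intro μ _ hμ
    rw [Pi.single_eq_of_ne hμ, zero_smul]
  · simp

/-! ### Forms with values in the line bundle -/

theorem BalancedTensor.mk_sum {R M N : Type*} [Ring R] [AddCommGroup M] [Module Rᵐᵒᵖ M]
    [AddCommGroup N] [Module R N] {ι : Type*} (s : Finset ι) (m : M) (x : ι → N) :
    BalancedTensor.mk R m (∑ i ∈ s, x i) = ∑ i ∈ s, BalancedTensor.mk R m (x i) := by
  simp only [BalancedTensor.mk, TensorProduct.tmul_sum]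
  exact map_sum (QuotientAddGroup.mk' _) _ _

theorem BalancedTensor.add_mk {R M N : Type*} [Ring R] [AddCommGroup M] [Module Rᵐᵒᵖ M]
    [AddCommGroup N] [Module R N] (m m' : M) (x : N) :
    BalancedTensor.mk R (m + m') x = BalancedTensor.mk R m x + BalancedTensor.mk R m' x := by
  simp only [BalancedTensor.mk, TensorProduct.add_tmul]
  rfl

theorem BalancedTensor.zero_mk {R M N : Type*} [Ring R] [AddCommGroup M] [Module Rᵐᵒᵖ M]
    [AddCommGroup N] [Module R N] (x : N) : BalancedTensor.mk R (0 : M) x = 0 := by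
  simp only [BalancedTensor.mk, TensorProduct.zero_tmul]
  rfl

@[simp] theorem formMul_mk (α : OmegaSphere q) (φ : LineBundle q n) :
    formMul q n (BalancedTensor.mk (Sphere q) α φ) =
      MulOpposite.op (φ : SUq q) • (α : Omega q) := rfl

/-- A balanced tensor is recovered from its image `t̄` in the one-forms of `SU_q(2)` as
`∑ μ, (t̄ Ψ_μ⋆) ⊗ Ψ_μ`. -/
theorem exists_eq_sum_formMul (t : BalancedTensor (Sphere q) (OmegaSphere q) (LineBundle q n)) :
    ∃ h : ∀ μ, MulOpposite.op (star (Psi q n μ)) • formMul q n t ∈ OmegaSphere q,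
      t = ∑ μ, BalancedTensor.mk (Sphere q) (⟨_, h μ⟩ : OmegaSphere q)
        (⟨Psi q n μ, Psi_mem_lineBundle q n μ⟩ : LineBundle q n) := by
  induction t using BalancedTensor.induction with
  | h0 =>
    have h : ∀ μ, MulOpposite.op (star (Psi q n μ)) • formMul q n 0 ∈ OmegaSphere q := by
      simp
    refine ⟨h, (Finset.sum_eq_zero fun μ _ => ?_).symm⟩
    have e : (⟨_, h μ⟩ : OmegaSphere q) = 0 := Subtype.ext (by simp)
    rw [e, BalancedTensor.zero_mk]
  | hmk α φ =>
    have e : ∀ μ, MulOpposite.op (star (Psi q n μ)) •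
        formMul q n (BalancedTensor.mk (Sphere q) α φ) =
          ((MulOpposite.op (lineRow q n φ μ) • α : OmegaSphere q) : Omega q) := by
      intro μ
      rw [formMul_mk, smul_smul, ← MulOpposite.op_mul]; rfl
    refine ⟨fun μ => by rw [e]; exact Subtype.mem _, ?_⟩
    simp only [e, Subtype.coe_eta, BalancedTensor.mk_op_smul]
    rw [← BalancedTensor.mk_sum]
    congr 1
    exact (rowPairing_lineRow φ).symm
  | hadd s t hs ht =>
    obtain ⟨h1, e1⟩ := hs
    obtain ⟨h2, e2⟩ := ht
    have e : ∀ μ, MulOpposite.op (star (Psi q n μ)) • formMul q n (s + t) =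
        MulOpposite.op (star (Psi q n μ)) • formMul q n s +
          MulOpposite.op (star (Psi q n μ)) • formMul q n t := by
      intro μ; rw [map_add, smul_add]
    refine ⟨fun μ => by rw [e]; exact add_mem (h1 μ) (h2 μ), ?_⟩
    conv_lhs => rw [e1, e2]
    rw [← Finset.sum_add_distrib]
    refine Finset.sum_congr rfl fun μ _ => ?_
    rw [← BalancedTensor.add_mk]
    congr 1
    exact Subtype.ext (e μ).symm

theorem formMul_injective (q : Set.Ioo (0 : ℝ) 1) (n : ℤ) : Function.Injective (formMul q n) := by
  rw [injective_iff_map_eq_zero]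
  intro t ht
  obtain ⟨h, e⟩ := exists_eq_sum_formMul t
  rw [e]
  refine Finset.sum_eq_zero fun μ _ => ?_
  have e' : (⟨_, h μ⟩ : OmegaSphere q) = 0 := Subtype.ext (by simp [ht])
  rw [e', BalancedTensor.zero_mk]

/-! ### The connection -/

theorem opE_mul_eq_zero {x y : SUq q} (hx : opE q x = 0) (hy : opE q y = 0) :
    opE q (x * y) = 0 := by
  rw [opE_mul, hx, hy, zero_mul, mul_zero, add_zero]

theorem opF_mul_eq_zero {x y : SUq q} (hx : opF q x = 0) (hy : opF q y = 0) :
    opF q (x * y) = 0 := by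
  rw [opF_mul, hx, hy, zero_mul, mul_zero, add_zero]

theorem opE_one (q : Set.Ioo (0 : ℝ) 1) : opE q 1 = 0 := by
  simp [opE, leftAct, pairE, Algebra.TensorProduct.one_def]

theorem opF_one (q : Set.Ioo (0 : ℝ) 1) : opF q 1 = 0 := by
  simp [opF, leftAct, pairF, Algebra.TensorProduct.one_def]

theorem opE_pow_eq_zero {x : SUq q} (hx : opE q x = 0) (k : ℕ) : opE q (x ^ k) = 0 := by
  induction k with
  | zero => rw [pow_zero, opE_one]
  | succ k ih => rw [pow_succ, opE_mul_eq_zero ih hx]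

theorem opF_pow_eq_zero {x : SUq q} (hx : opF q x = 0) (k : ℕ) : opF q (x ^ k) = 0 := by
  induction k with
  | zero => rw [pow_zero, opF_one]
  | succ k ih => rw [pow_succ, opF_mul_eq_zero ih hx]

/-- The vectors `Ψ` are polynomials in `a⋆, c⋆`, annihilated by `E`, or in `a, c`, annihilated
by `F`; their adjoints are polynomials in the other pair. -/
theorem opE_opF_Psi (q : Set.Ioo (0 : ℝ) 1) (n : ℤ) :
    (∀ μ, opE q (Psi q n μ) = 0 ∧ opF q (star (Psi q n μ)) = 0) ∨
      (∀ μ, opF q (Psi q n μ) = 0 ∧ opE q (star (Psi q n μ)) = 0) := by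
  obtain ⟨-, hE1, -, hE2⟩ := opE_gen q
  obtain ⟨hF1, -, hF2, -⟩ := opF_gen q
  unfold Psi
  split_ifs with h
  · refine Or.inl fun μ => ⟨?_, ?_⟩
    · rw [map_smul, opE_mul_eq_zero (opE_pow_eq_zero hE2 _) (opE_pow_eq_zero hE1 _), smul_zero]
    · rw [star_smul, map_smul, star_mul, star_pow, star_pow, star_aS, star_cS,
        opF_mul_eq_zero (opF_pow_eq_zero hF1 _) (opF_pow_eq_zero hF2 _), smul_zero]
  · refine Or.inr fun μ => ⟨?_, ?_⟩
    · rw [map_smul, opF_mul_eq_zero (opF_pow_eq_zero hF2 _) (opF_pow_eq_zero hF1 _), smul_zero]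
    · rw [star_smul, map_smul, star_mul, star_pow, star_pow, star_a, star_c,
        opE_mul_eq_zero (opE_pow_eq_zero hE1 _) (opE_pow_eq_zero hE2 _), smul_zero]

/-- Each of `X_±` annihilates all `Ψ_ν` or all `Ψ_ν⋆`. -/
theorem vf_Psi {i : Dir} (hi : i ≠ Dir.z) :
    (∀ ν, vf q i (Psi q n ν) = 0) ∨ (∀ ν, vf q i (star (Psi q n ν)) = 0) := by
  have hK : ∀ ν, opK q (Psi q n ν) = (qHalf q)⁻¹ ^ (-n) • Psi q n ν := fun ν =>
    opK_weightSpace (coaction_Psi q n ν)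
  have hKs : ∀ ν, opK q (star (Psi q n ν)) = (qHalf q)⁻¹ ^ n • star (Psi q n ν) := fun ν =>
    opK_weightSpace (coaction_star_Psi q n ν)
  cases i with
  | z => exact absurd rfl hi
  | minus =>
    rcases opE_opF_Psi q n with h | h
    · exact Or.inr fun ν => by simp [vf, hKs, (h ν).2]
    · exact Or.inl fun ν => by simp [vf, hK, (h ν).1]
  | plus =>
    rcases opE_opF_Psi q n with h | h
    · exact Or.inl fun ν => by simp [vf, hK, (h ν).1]
    · exact Or.inr fun ν => by simp [vf, hKs, (h ν).2]

theorem vf_one (q : Set.Ioo (0 : ℝ) 1) (i : Dir) : vf q i 1 = 0 := by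
  have h := vf_mul q i 1 1
  rwa [mul_one, opK_pow_one, mul_one, one_mul, left_eq_add] at h

theorem vf_z_sphere {b : SUq q} (hb : b ∈ Sphere q) : vf q Dir.z b = 0 := by
  simp only [vf, LinearMap.smul_apply, LinearMap.sub_apply, LinearMap.id_apply,
    opK_pow_sphere hb, sub_self, smul_zero]

/-- The horizontal components of `∑ dΨ_ν⋆ Ψ_ν` vanish. -/
theorem sum_vf_star_Psi_mul {i : Dir} (hi : i ≠ Dir.z) :
    ∑ ν, vf q i (star (Psi q n ν)) * (opK q ^ wt i) (Psi q n ν) = 0 := by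
  rcases vf_Psi (q := q) (n := n) hi with h | h
  · have e := vf_one q i
    rw [← sum_star_Psi_mul_Psi q n, map_sum] at e
    rw [← e]
    refine Finset.sum_congr rfl fun ν _ => ?_
    rw [vf_mul, h, mul_zero, add_zero]
  · simp [h]

theorem coeff_sum {ι : Type*} (s : Finset ι) (α : ι → Omega q) (i : Dir) :
    Omega.coeff (∑ j ∈ s, α j) i = ∑ j ∈ s, Omega.coeff (α j) i :=
  map_sum (AddMonoidHom.mk' (fun α : Omega q => Omega.coeff α i) fun _ _ => rfl) _ _

theorem coeff_covDeriv (φ : SUq q) (i : Dir) :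
    Omega.coeff (covDeriv q φ) i = if i = Dir.z then 0 else vf q i φ := by
  have h : Omega.coeff (vertProj q (d q φ)) i = vf q Dir.z φ * (if i = Dir.z then 1 else 0) := rfl
  rw [covDeriv, Omega.coeff_sub, coeff_d, h]
  split_ifs with hi
  · rw [hi, mul_one, sub_self]
  · rw [mul_zero, sub_zero]

/-- The covariant derivative is the Grassmann connection in terms of one-forms on `SU_q(2)`. -/
theorem sum_d_mul_Psi (φ : LineBundle q n) :
    ∑ ν, MulOpposite.op (Psi q n ν) • d q ((φ : SUq q) * star (Psi q n ν)) =
      covDeriv q (φ : SUq q) := by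
  ext i
  rw [coeff_sum, coeff_covDeriv]
  simp only [Omega.coeff_op_smul, coeff_d]
  split_ifs with hi
  · subst hi
    exact Finset.sum_eq_zero fun ν _ => by
      rw [vf_z_sphere (mul_star_Psi_mem_sphere φ.2 ν), zero_mul]
  · simp only [vf_mul, add_mul, mul_assoc, ← opK_pow_mul, Finset.sum_add_distrib,
      ← Finset.mul_sum, ← map_sum]
    rw [sum_star_Psi_mul_Psi, opK_pow_one, mul_one, sum_vf_star_Psi_mul hi, mul_zero, add_zero]

/-- The connection `∇φ = ∑ ν, d(φ Ψ_ν⋆) ⊗ Ψ_ν` of the line bundle. -/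
def lineConnection (q : Set.Ioo (0 : ℝ) 1) (n : ℤ) (φ : LineBundle q n) :
    BalancedTensor (Sphere q) (OmegaSphere q) (LineBundle q n) :=
  ∑ ν, BalancedTensor.mk (Sphere q) (dSphere q (lineRow q n φ ν))
    (⟨Psi q n ν, Psi_mem_lineBundle q n ν⟩ : LineBundle q n)

theorem formMul_lineConnection (φ : LineBundle q n) :
    formMul q n (lineConnection q n φ) = covDeriv q (φ : SUq q) := by
  rw [lineConnection, map_sum, ← sum_d_mul_Psi]
  rfl

theorem congr_lineConnection (φ : LineBundle q n) :
    BalancedTensor.congr (OmegaSphere q) (sectionEquiv q n) (lineConnection q n φ) =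
      grassmann q n (sectionEquiv q n φ) := by
  rw [lineConnection, map_sum, grassmann]
  refine Finset.sum_congr rfl fun ν _ => ?_
  rw [← sectionEquiv_Psi]
  rfl

theorem sum_op_projMatrix_smul_dSphere (φ : LineBundle q n) (μ : Fin (n.natAbs + 1)) :
    ((∑ ν, MulOpposite.op (projMatrix q n ν μ) • dSphere q (lineRow q n φ ν) : OmegaSphere q) :
        Omega q) = MulOpposite.op (star (Psi q n μ)) • covDeriv q (φ : SUq q) := by
  rw [← sum_d_mul_Psi, Finset.smul_sum, AddSubmonoidClass.coe_finsetSum]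
  refine Finset.sum_congr rfl fun ν _ => ?_
  rw [smul_smul, ← MulOpposite.op_mul]
  rfl

end QuantumHopf
end

theorem mainTheorem4 (q : Set.Ioo (0 : ℝ) 1) (n : ℤ) :
    ∃ σ : LineBundle q n ≃ₗ[Sphere q] Sections q n,
      (∀ (φ : LineBundle q n) (μ : Fin (n.natAbs + 1)),
        (((σ φ : Fin (n.natAbs + 1) → Sphere q) μ : Sphere q) : SUq q)
          = (φ : SUq q) * star (Psi q n μ)) ∧
      (∀ f : Fin (n.natAbs + 1) → Sphere q,
        (σ.symm (sectionOf q n f) : SUq q) = ∑ μ, (f μ : SUq q) * Psi q n μ) ∧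
      Function.Injective (formMul q n) ∧
      ∃ nabla : LineBundle q n →
          BalancedTensor (Sphere q) (OmegaSphere q) (LineBundle q n),
        (∀ φ : LineBundle q n, formMul q n (nabla φ) = covDeriv q (φ : SUq q)) ∧
        (∀ φ : LineBundle q n,
          BalancedTensor.congr (OmegaSphere q) σ (nabla φ) = grassmann q n (σ φ)) ∧
        (∀ (φ : LineBundle q n) (μ : Fin (n.natAbs + 1)),
          ((∑ ν, MulOpposite.op (projMatrix q n ν μ) •
              dSphere q ((σ φ : Fin (n.natAbs + 1) → Sphere q) ν) : OmegaSphere q) : Omega q)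
            = MulOpposite.op (star (Psi q n μ)) • covDeriv q (φ : SUq q)) := by
  refine ⟨sectionEquiv q n, fun _ _ => rfl, fun f => ?_, formMul_injective q n,
    lineConnection q n, formMul_lineConnection, congr_lineConnection,
    sum_op_projMatrix_smul_dSphere⟩
  rw [sectionEquiv_symm_sectionOf, coe_rowPairing]
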